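/- **Notation.** For an integer $n$ let $(x)_n=x(x+1)\cdots(x+n-1)$ if $n>0$, $(x)_0=1$, $(x)_n=\frac1{(x-1)(x-2)\cdots(x+n)}$ if $n<0$; and $[x]_n=x(x+2)\cdots(x+2(n-1))$ if $n>0$, $[x]_0=1$, $[x]_n=\frac1{(x-2)(x-4)\cdots(x+2n)}$ if $n<0$. For an integer $m>0$ put $$\operatorname{T}(x,n,m)=\prod_{i=0}^{m-1}(x+i)_{n-2i},\qquad \operatorname{V}(x,n,m)=\prod_{i=0}^{m-1}[x+2i]_{n-2i},$$ with value $1$ for $m=0$, and $\operatorname{T}(x,n,m)=\operatorname{T}(x,n,-m)^{-1}$, $\operatorname{V}(x,n,m)=\operatorname{V}(x,n,-m)^{-1}$ for $m<0$. A lozenge is the union of two unit triangles of the triangular lattice that share an edge, and $\operatorname{M}(R)$ is the number of tilings of a region $R$ by lozenges (without gaps or overlaps). **Regions.** Use the triangular lattice whose points are $(X,y)\in\mathbb Z^2$ with $X+y$ even, where $(X,y)$ stands for the point $(X/2,\,y\sqrt3/2)$ of the plane, so that one family of lattice lines is horizontal. Let $x,a,b,c$ be non-negative integers. * For $a\le b$,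 $P_{a,b,c}$ is the hexagon of side lengths $a,b,c,a,b,c$ (counterclockwise, starting from the northwestern side; the northern and southern sides are horizontal) whose northern side has left endpoint $(1,1)$, with a maximal staircase cut off at its western corner: only the unit triangles in the half plane $X\ge 0$ are kept. * $B_{x,a,b,c}$ is obtained as follows. Start with the halved hexagon whose northern, northeastern, southeastern, southern and southwestern sides have lengths $x+a$, $b+c$, $2a+c+1$, $x$, $b$, respectively, where the southwestern side ends at $(0,0)$, the northern side starts at $(1,2a+2c+1)$, and the western side is the zigzag lattice path $(0,0),(1,1),(0,2),(1,3),\dots,(0,2a+2c),(1,2a+2c+1)$. Then remove from its western side half of a down-pointing triangle of side $2a$: the part lying in the halved hexagon of the down-pointing triangle of side $2a$ with lowest vertex $(1,1)$ and horizontal side from $(1-2a,2a+1)$ to $(1+2a,2a+1)$. **Theorem.** For any non-negative integers $x,a,b,c$, $$\operatorname{M}(B_{x,a,b,c})=\operatorname{M}(P_{c,c,a})\,\frac{\operatorname{V}(2x+2a+b+2,\,c,\,\lfloor\frac{c+1}{2}\rfloor)}{\operatorname{V}(2a+b+2,\,c,\,\lfloor\frac{c+1}{2}\rfloor)}\cdot\frac{\operatorname{T}(x+1,\,2a+b+c,\,b)\,\operatorname{T}(x+a+\frac{b+3}{2},\,c-1,\,\lfloor\frac{c+1}{2}\rfloor)}{\operatorname{T}(1,\,2a+b+c,\,b)\,\operatorname{T}(a+\frac{b+3}{2},\,c-1,\,\lfloor\frac{c+1}{2}\rfloor)}$$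 if $b$ is odd, and $$\operatorname{M}(B_{x,a,b,c})=\operatorname{M}(P_{c,c,a})\,\frac{\operatorname{V}(2x+2a+b+3,\,c-1,\,\lfloor\frac{c+1}{2}\rfloor)}{\operatorname{V}(2a+b+3,\,c-1,\,\lfloor\frac{c+1}{2}\rfloor)}\cdot\frac{\operatorname{T}(x+1,\,2a+b+c,\,b)\,\operatorname{T}(x+a+\frac{b+2}{2},\,c,\,\lfloor\frac{c+1}{2}\rfloor)}{\operatorname{T}(1,\,2a+b+c,\,b)\,\operatorname{T}(a+\frac{b+2}{2},\,c,\,\lfloor\frac{c+1}{2}\rfloor)}$$ if $b$ is even. -/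

import Mathlib

/-! ### The triangular lattice

The lattice points are the pairs `(X, y)` of integers with `X + y` even; the pair `(X, y)` stands for
the point `(X / 2, y * √3 / 2)` of the plane. So the lattice lines are the horizontal lines
`y = const` and the two families `X + y = const` and `X - y = const`, neighbouring lattice points
are at distance `1`, and a lattice segment along a line of one of the last two families that
crosses `k` rows has length `k`. -/

/-- The unit triangles of the triangular lattice: `(X, y)` is the unit triangle that lies between
the horizontal lattice lines at heights `y` and `y + 1` and spans the interval `[X - 1, X + 1]`
horizontally. It is up-pointing when `X + y` is odd, down-pointing when `X + y` is even. -/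
abbrev TriCell : Type := ℤ × ℤ

/-- The three corners of a unit triangle. -/
def TriCell.corners (t : TriCell) : Finset (ℤ × ℤ) :=
  if Even (t.1 + t.2) then {(t.1 - 1, t.2 + 1), (t.1 + 1, t.2 + 1), (t.1, t.2)}
  else {(t.1 - 1, t.2), (t.1 + 1, t.2), (t.1, t.2 + 1)}

/-- Two unit triangles share an edge: they are different and have two common corners. -/
def TriCell.SharesEdge (s t : TriCell) : Prop :=
  s ≠ t ∧ (s.corners ∩ t.corners).card = 2

/-- A lozenge: the union of two unit triangles that share an edge. -/
def IsLozenge (L : Finset TriCell) : Prop :=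
  ∃ s t : TriCell, s.SharesEdge t ∧ L = {s, t}

/-- A lozenge tiling of a region (a set of unit triangles): a set of lozenges contained in the
region such that every unit triangle of the region is covered by exactly one of them. -/
def IsLozengeTiling (R : Set TriCell) (𝒯 : Set (Finset TriCell)) : Prop :=
  (∀ L ∈ 𝒯, IsLozenge L ∧ ∀ t ∈ L, t ∈ R) ∧ ∀ t ∈ R, ∃! L : Finset TriCell, L ∈ 𝒯 ∧ t ∈ L

/-- The number of lozenge tilings of a (finite) region. -/
noncomputable def tilingNumber (R : Set TriCell) : ℕ :=
  {𝒯 : Set (Finset TriCell) | IsLozengeTiling R 𝒯}.ncard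

/-! ### The regions

In both families the axis of the halving is the vertical line `X = 0`. Among the lattice points
on or to the right of this line the leftmost ones in consecutive rows alternate between `X = 0` and
`X = 1`, so keeping the unit triangles that lie in the half plane `X ≥ 0` produces the zigzag
western boundary. -/

/-- The halved hexagon `P_{a,b,c}` (for `a ≤ b`). The semi-regular hexagon has its sides on the lines
`X - y = 0` (northwest), `X + y = 2 - 2a` (southwest), `y = 1 - a - b` (south),
`X - y = 2c + 2b` (southeast), `X + y = 2c + 2` (northeast), `y = 1` (north), of lengths
`a, b, c, a, b, c`; the northern side starts at the point `(1, 1)`. The condition `0 ≤ X` cuts off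
the maximal staircase at the western corner: the zigzag runs from `(1, 1)` through
`(0, 0), (1, -1), (0, -2), …` down to the southwestern side. -/
def regionP (a b c : ℕ) : Set TriCell :=
  {t | ∀ p ∈ t.corners,
    0 ≤ p.1 ∧
    0 ≤ p.1 - p.2 ∧
    2 - 2 * (a : ℤ) ≤ p.1 + p.2 ∧
    1 - (a : ℤ) - b ≤ p.2 ∧
    p.1 - p.2 ≤ 2 * (c : ℤ) + 2 * b ∧
    p.1 + p.2 ≤ 2 * (c : ℤ) + 2 ∧
    p.2 ≤ 1}

/-- The halved hexagon with straight sides, clockwise from the north: the northern side of length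
`x + a` from `(1, 2a + 2c + 1)`, the northeastern side of length `b + c`, the southeastern side
of length `2a + c + 1`, the southern side of length `x` ending at `(b, -b)`, and the
southwestern side of length `b` from `(b, -b)` to `(0, 0)`. The western side is the zigzag
`(0, 0), (1, 1), (0, 2), (1, 3), …, (1, 2a + 2c + 1)`. -/
def halvedHexagon (x a b c : ℕ) : Set TriCell :=
  {t | ∀ p ∈ t.corners,
    0 ≤ p.1 ∧
    0 ≤ p.1 + p.2 ∧
    -(b : ℤ) ≤ p.2 ∧
    p.1 - p.2 ≤ 2 * (x : ℤ) + 2 * b ∧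
    p.1 + p.2 ≤ 2 * (x : ℤ) + 4 * a + 2 * c + 2 ∧
    p.2 ≤ 2 * (a : ℤ) + 2 * c + 1}

/-- The down-pointing triangle of side `2a` with lowest point `(1, 1)`; its horizontal side runs from
`(1 - 2a, 2a + 1)` to `(1 + 2a, 2a + 1)`. It is symmetric about the line `X = 1`. -/
def downTriangle (a : ℕ) : Set TriCell :=
  {t | ∀ p ∈ t.corners, p.1 ≤ p.2 ∧ 2 ≤ p.1 + p.2 ∧ p.2 ≤ 2 * (a : ℤ) + 1}

/-- The region `B_{x,a,b,c}`: the halved hexagon with the part of the down-pointing triangle of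
side `2a` that lies in it removed. This part is the right half of the triangle, with the zigzag as
its western boundary. The lowest point `(1, 1)` of the triangle is the point of the zigzag next to
the end `(0, 0)` of the southwestern side. -/
def regionB (x a b c : ℕ) : Set TriCell :=
  halvedHexagon x a b c \ downTriangle a

/-! ### Pochhammer symbols and trapezoidal products -/

/-- The Pochhammer symbol `(x)_n` for an integer `n`: it is `x (x + 1) ⋯ (x + n - 1)` for `n ≥ 0` and
`1 / ((x - 1) (x - 2) ⋯ (x + n))` for `n < 0`. -/
def poch (x : ℚ) (n : ℤ) : ℚ :=
  if 0 ≤ n then ∏ i ∈ Finset.range n.toNat, (x + i)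
  else (∏ i ∈ Finset.range (-n).toNat, (x - (i + 1)))⁻¹

/-- The skipped Pochhammer symbol `[x]_n` for an integer `n`: it is
`x (x + 2) ⋯ (x + 2 (n - 1))` for `n ≥ 0` and `1 / ((x - 2) (x - 4) ⋯ (x + 2n))` for `n < 0`. -/
def skipPoch (x : ℚ) (n : ℤ) : ℚ :=
  if 0 ≤ n then ∏ i ∈ Finset.range n.toNat, (x + 2 * i)
  else (∏ i ∈ Finset.range (-n).toNat, (x - 2 * (i + 1)))⁻¹

/-- The trapezoidal product `T(x, n, m)`: it is `∏_{i=0}^{m-1} (x + i)_{n - 2i}` for `m ≥ 0` and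
`T(x, n, -m)⁻¹` for `m < 0`. -/
def trapT (x : ℚ) (n m : ℤ) : ℚ :=
  if 0 ≤ m then ∏ i ∈ Finset.range m.toNat, poch (x + i) (n - 2 * i)
  else (∏ i ∈ Finset.range (-m).toNat, poch (x + i) (n - 2 * i))⁻¹

/-- The trapezoidal product `V(x, n, m)`: it is `∏_{i=0}^{m-1} [x + 2i]_{n - 2i}` for `m ≥ 0` and
`V(x, n, -m)⁻¹` for `m < 0`. -/
def trapV (x : ℚ) (n m : ℤ) : ℚ :=
  if 0 ≤ m then ∏ i ∈ Finset.range m.toNat, skipPoch (x + 2 * i) (n - 2 * i)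
  else (∏ i ∈ Finset.range (-m).toNat, skipPoch (x + 2 * i) (n - 2 * i))⁻¹

/-! ### Lozenges and adjacency -/

/-! Read row by row, a tiling is a family of nonintersecting walks. In each row a walk occupies an
up-pointing triangle, passes to the down-pointing triangle on its left or right with which it forms
a lozenge, and continues in the up-pointing triangle above that. Every unoccupied up-pointing
triangle is paired with its lower neighbour. Expanding a determinant row by row (the
Lindström–Gessel–Viennot argument, `tilingNumber_belowLine_succ_eq_det`) counts such families, and
`upCount_eq_det_of_new_cells` lets walks start on a horizontal side.

A walk moves one unit per row, so the sloping sides, including that of the removed triangle, impose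
no condition. The zigzag side is an absorbing wall, handled by reflection: source functions are made
odd. Hence both regions are counted by `tilingMatrix`, with `a` sources at 2, 4, …, 2a and, for B,
also `x` sources on the southern side. For x = 0 the matrices coincide, so B and P have equally many
tilings.

To evaluate the determinant, unitriangular row operations replace the endpoints 2, 4, … by the
single endpoint 2 reached after different numbers of steps (`det_tilingMatrix`). The weights are
ballot numbers, that is, a common factor times a polynomial in the squared position, so the
polynomials may be exchanged for any monic basis. A basis vanishing at the `a` short sources makes
the matrix block triangular (`det_evenFunctional_eq_mul`). One block is a Vandermonde matrix in
squares, depending on `a` only. In the other, two Vandermonde convolutions leave quotients of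
factorials, evaluated by `abs_det_factorial_quotient`.

The resulting product gives an explicit quotient of consecutive values in `x`
(`tilingProduct_succ`). The trapezoidal products have the same quotient, since a unit shift of their
argument changes each factor by two linear terms. The theorem follows by induction on `x` from x =
0. -/

theorem TriCell.corners_of_even {X y : ℤ} (h : Even (X + y)) :
    TriCell.corners (X, y) = {(X - 1, y + 1), (X + 1, y + 1), (X, y)} := if_pos h

theorem TriCell.corners_of_odd {X y : ℤ} (h : Odd (X + y)) :
    TriCell.corners (X, y) = {(X - 1, y), (X + 1, y), (X, y + 1)} :=
  if_neg (Int.not_even_iff_odd.2 h)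

theorem TriCell.SharesEdge.symm {s t : TriCell} (h : s.SharesEdge t) : t.SharesEdge s :=
  ⟨h.1.symm, by rw [Finset.inter_comm]; exact h.2⟩

theorem TriCell.sharesEdge_of_inter_eq {s t : TriCell} {p q : ℤ × ℤ} (hne : s ≠ t) (hpq : p ≠ q)
    (h : s.corners ∩ t.corners = {p, q}) : s.SharesEdge t :=
  ⟨hne, by rw [h]; exact Finset.card_pair hpq⟩

theorem TriCell.sharesEdge_right (X y : ℤ) : TriCell.SharesEdge (X, y) (X + 1, y) := by
  rcases Int.even_or_odd (X + y) with e | e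
  · have e2 : Odd (X + 1 + y) := by simp only [Int.even_iff, Int.odd_iff] at *; omega
    refine sharesEdge_of_inter_eq (p := (X + 1, y + 1)) (q := (X, y)) (by simp) (by simp) ?_
    rw [corners_of_even e, corners_of_odd e2]
    ext ⟨u, v⟩
    simp only [Finset.mem_inter, Finset.mem_insert, Finset.mem_singleton, Prod.mk.injEq]
    omega
  · have e2 : Even (X + 1 + y) := by simp only [Int.even_iff, Int.odd_iff] at *; omega
    refine sharesEdge_of_inter_eq (p := (X, y + 1)) (q := (X + 1, y)) (by simp) (by simp) ?_
    rw [corners_of_odd e, corners_of_even e2]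
    ext ⟨u, v⟩
    simp only [Finset.mem_inter, Finset.mem_insert, Finset.mem_singleton, Prod.mk.injEq]
    omega

theorem TriCell.sharesEdge_left (X y : ℤ) : TriCell.SharesEdge (X, y) (X - 1, y) := by
  simpa using (sharesEdge_right (X - 1) y).symm

theorem TriCell.sharesEdge_below {X y : ℤ} (e : Odd (X + y)) :
    TriCell.SharesEdge (X, y) (X, y - 1) := by
  have e2 : Even (X + (y - 1)) := by simp only [Int.even_iff, Int.odd_iff] at *; omega
  refine sharesEdge_of_inter_eq (p := (X - 1, y)) (q := (X + 1, y))
    (by simp only [ne_eq, Prod.mk.injEq]; omega)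
    (by simp only [ne_eq, Prod.mk.injEq]; omega) ?_
  rw [corners_of_odd e, corners_of_even e2]
  ext ⟨u, v⟩
  simp only [Finset.mem_inter, Finset.mem_insert, Finset.mem_singleton, Prod.mk.injEq]
  omega

set_option maxHeartbeats 2000000 in
theorem TriCell.sharesEdge_cases {X y X' y' : ℤ} (h : TriCell.SharesEdge (X, y) (X', y')) :
    (y' = y ∧ (X' = X - 1 ∨ X' = X + 1)) ∨ (Even (X + y) ∧ X' = X ∧ y' = y + 1) ∨
      (Odd (X + y) ∧ X' = X ∧ y' = y - 1) := by
  obtain ⟨hne, hcard⟩ := h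
  obtain ⟨⟨p1, p2⟩, ⟨q1, q2⟩, hpq, h⟩ := Finset.card_eq_two.1 hcard
  have hp : (p1, p2) ∈ TriCell.corners (X, y) ∩ TriCell.corners (X', y') := by rw [h]; simp
  have hq : (q1, q2) ∈ TriCell.corners (X, y) ∩ TriCell.corners (X', y') := by rw [h]; simp
  clear h hcard
  rw [Finset.mem_inter] at hp hq
  obtain ⟨hp, hp'⟩ := hp
  obtain ⟨hq, hq'⟩ := hq
  rcases Int.even_or_odd (X + y) with e1 | e1 <;> rcases Int.even_or_odd (X' + y') with e2 | e2
  all_goals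
    first
    | rw [corners_of_even e1] at hp hq
    | rw [corners_of_odd e1] at hp hq
    first
    | rw [corners_of_even e2] at hp' hq'
    | rw [corners_of_odd e2] at hp' hq'
    simp only [Finset.mem_insert, Finset.mem_singleton, Prod.mk.injEq, ne_eq] at hp hq hp' hq' hne hpq
    simp only [Int.even_iff, Int.odd_iff] at *
    -- Each of the two common corners is identified with a corner of either triangle; linear
    -- arithmetic and parity settle every combination.
    rcases hp with hp | hp | hp <;> rcases hp' with hp' | hp' | hp' <;>
    rcases hq with hq | hq | hq <;> rcases hq' with hq' | hq' | hq' <;>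
    omega

/-! ### Tilings with prescribed lozenges -/

theorem IsLozengeTiling.eq_of_mem {R : Set TriCell} {𝒯 : Set (Finset TriCell)}
    (h : IsLozengeTiling R 𝒯) {L L' : Finset TriCell} (hL : L ∈ 𝒯) (hL' : L' ∈ 𝒯) {t : TriCell}
    (ht : t ∈ L) (ht' : t ∈ L') : L = L' :=
  (h.2 t ((h.1 L hL).2 t ht)).unique ⟨hL, ht⟩ ⟨hL', ht'⟩

theorem IsLozenge.nonempty {L : Finset TriCell} (h : IsLozenge L) : L.Nonempty := by
  obtain ⟨s, t, _, rfl⟩ := h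
  exact ⟨s, by simp⟩

theorem IsLozenge.exists_partner {L : Finset TriCell} (h : IsLozenge L) {s : TriCell}
    (hs : s ∈ L) : ∃ t, s.SharesEdge t ∧ L = {s, t} := by
  obtain ⟨u, v, huv, rfl⟩ := h
  simp only [Finset.mem_insert, Finset.mem_singleton] at hs
  rcases hs with rfl | rfl
  · exact ⟨v, huv, rfl⟩
  · exact ⟨u, huv.symm, Finset.pair_comm _ _⟩

theorem finite_setOf_isLozengeTiling {R : Set TriCell} (hR : R.Finite) :
    {𝒯 | IsLozengeTiling R 𝒯}.Finite := by
  have h1 : {L : Finset TriCell | (L : Set TriCell) ⊆ R}.Finite := by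
    refine (hR.toFinset.powerset.finite_toSet).subset fun L hL => ?_
    simp only [Finset.coe_powerset, Set.mem_preimage, Set.mem_powerset_iff]
    intro t ht
    simpa using hL ht
  exact h1.finite_subsets.subset fun 𝒯 h L hL t ht => (h.1 L hL).2 t ht

theorem tilingNumber_empty : tilingNumber ∅ = 1 := by
  rw [tilingNumber, Set.ncard_eq_one]
  refine ⟨∅, Set.eq_singleton_iff_unique_mem.2 ⟨⟨by simp, by simp⟩, fun 𝒯 h => ?_⟩⟩
  refine Set.eq_empty_of_forall_notMem fun L hL => ?_
  obtain ⟨t, ht⟩ := (h.1 L hL).1.nonempty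
  exact (h.1 L hL).2 t ht

/-- The tilings that contain a given family of disjoint lozenges are the tilings of the rest. -/
theorem ncard_setOf_isLozengeTiling_superset {R : Set TriCell} {𝓛 : Set (Finset TriCell)}
    (h𝓛 : ∀ L ∈ 𝓛, IsLozenge L ∧ ∀ t ∈ L, t ∈ R)
    (hdisj : ∀ L ∈ 𝓛, ∀ L' ∈ 𝓛, ∀ t ∈ L, t ∈ L' → L = L') :
    {𝒯 | IsLozengeTiling R 𝒯 ∧ 𝓛 ⊆ 𝒯}.ncard = tilingNumber (R \ {t | ∃ L ∈ 𝓛, t ∈ L}) := by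
  -- The inverse map is the union with `𝓛`.
  refine Set.ncard_congr (fun 𝒯 _ => 𝒯 \ 𝓛) ?_ ?_ ?_
  · rintro 𝒯 ⟨h, hsub⟩
    refine ⟨fun L hL => ⟨(h.1 L hL.1).1, fun t ht => ⟨(h.1 L hL.1).2 t ht, ?_⟩⟩, ?_⟩
    · rintro ⟨L', hL', ht'⟩
      exact hL.2 (h.eq_of_mem hL.1 (hsub hL') ht ht' ▸ hL')
    · rintro t ⟨htR, ht⟩
      obtain ⟨L, ⟨hL, htL⟩, huniq⟩ := h.2 t htR
      exact ⟨L, ⟨⟨hL, fun hL' => ht ⟨L, hL', htL⟩⟩, htL⟩, fun L' hL' => huniq L' ⟨hL'.1.1, hL'.2⟩⟩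
  · rintro 𝒯 𝒯' ⟨_, h⟩ ⟨_, h'⟩ heq
    rw [← Set.sdiff_union_of_subset h, ← Set.sdiff_union_of_subset h']
    exact congrArg (· ∪ 𝓛) heq
  · intro 𝒯 h
    have hnot : ∀ L ∈ 𝒯, L ∉ 𝓛 := fun L hL hL' => by
      obtain ⟨t, ht⟩ := (h.1 L hL).1.nonempty
      exact ((h.1 L hL).2 t ht).2 ⟨L, hL', ht⟩
    refine ⟨𝒯 ∪ 𝓛, ⟨⟨?_, fun t ht => ?_⟩, Set.subset_union_right⟩, ?_⟩
    · rintro L (hL | hL)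
      · exact ⟨(h.1 L hL).1, fun t ht => ((h.1 L hL).2 t ht).1⟩
      · exact h𝓛 L hL
    · by_cases hc : ∃ L ∈ 𝓛, t ∈ L
      · obtain ⟨L, hL, htL⟩ := hc
        refine ⟨L, ⟨Or.inr hL, htL⟩, ?_⟩
        rintro L' ⟨hL' | hL', htL'⟩
        · exact absurd ⟨L, hL, htL⟩ ((h.1 L' hL').2 t htL').2
        · exact hdisj L' hL' L hL t htL' htL
      · obtain ⟨L, ⟨hL, htL⟩, huniq⟩ := h.2 t ⟨ht, hc⟩
        refine ⟨L, ⟨Or.inl hL, htL⟩, ?_⟩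
        rintro L' ⟨hL' | hL', htL'⟩
        · exact huniq L' ⟨hL', htL'⟩
        · exact absurd ⟨L', hL', htL'⟩ hc
    · ext L
      constructor
      · rintro ⟨hL | hL, hn⟩
        · exact hL
        · exact absurd hL hn
      · exact fun hL => ⟨Or.inl hL, hnot L hL⟩

open Classical in
/-- Sorting the tilings by the partners of some pairwise different cells `d i`, each of which has
only the possible partners `p i a`. -/
theorem tilingNumber_eq_sum_partners {ι α : Type*} [Fintype ι] [DecidableEq ι] [Fintype α] {R : Set TriCell}
    (hR : R.Finite) (d : ι → TriCell) (p : ι → α → TriCell) (hd : Function.Injective d)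
    (hdR : ∀ i, d i ∈ R) (hp : ∀ i, Function.Injective (p i))
    (hadj : ∀ i a, (d i).SharesEdge (p i a))
    (hpart : ∀ i, ∀ s ∈ R, (d i).SharesEdge s → ∃ a, s = p i a)
    (hdp : ∀ i j a, p i a ≠ d j) :
    tilingNumber R = ∑ f : ι → α,
      if (∀ i, p i (f i) ∈ R) ∧ Function.Injective (fun i => p i (f i)) then
        tilingNumber (R \ (Set.range d ∪ Set.range fun i => p i (f i))) else 0 := by
  have hfin := finite_setOf_isLozengeTiling hR
  have hex : ∀ 𝒯, IsLozengeTiling R 𝒯 → ∃ f : ι → α, ∀ i, ({d i, p i (f i)} : Finset _) ∈ 𝒯 := by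
    intro 𝒯 h
    have : ∀ i, ∃ a, ({d i, p i a} : Finset _) ∈ 𝒯 := fun i => by
      obtain ⟨L, ⟨hL, hiL⟩, -⟩ := h.2 _ (hdR i)
      obtain ⟨s, hs, rfl⟩ := (h.1 L hL).1.exists_partner hiL
      obtain ⟨a, rfl⟩ := hpart i s ((h.1 _ hL).2 s (by simp)) hs
      exact ⟨a, hL⟩
    choose f hf using this
    exact ⟨f, hf⟩
  have huni : ∀ 𝒯, IsLozengeTiling R 𝒯 → ∀ f g : ι → α, (∀ i, ({d i, p i (f i)} : Finset _) ∈ 𝒯) →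
      (∀ i, ({d i, p i (g i)} : Finset _) ∈ 𝒯) → f = g := by
    intro 𝒯 h f g hf hg
    funext i
    have e := h.eq_of_mem (hf i) (hg i) (t := d i) (by simp) (by simp)
    have : p i (f i) ∈ ({d i, p i (g i)} : Finset _) := by rw [← e]; simp
    simp only [Finset.mem_insert, hdp, Finset.mem_singleton, false_or] at this
    exact hp i this
  have hS : ∀ f : ι → α, {𝒯 | IsLozengeTiling R 𝒯 ∧ ∀ i, ({d i, p i (f i)} : Finset _) ∈ 𝒯}.Finite :=
    fun f => hfin.subset fun 𝒯 h => h.1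
  -- Each tiling determines exactly one choice `f` of partners, so the tilings split into disjoint
  -- classes.
  have hunion : hfin.toFinset = Finset.univ.biUnion fun f : ι → α => (hS f).toFinset := by
    ext 𝒯
    simp only [Set.Finite.mem_toFinset, Set.mem_ofPred_eq, Finset.mem_biUnion, Finset.mem_univ,
      true_and]
    exact ⟨fun h => (hex 𝒯 h).imp fun f hf => ⟨h, hf⟩, fun ⟨f, h⟩ => h.1⟩
  rw [tilingNumber, Set.ncard_eq_toFinset_card _ hfin, hunion, Finset.card_biUnion]
  · refine Finset.sum_congr rfl fun f _ => ?_
    rw [← Set.ncard_eq_toFinset_card _ (hS f)]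
    split_ifs with hf
    · obtain ⟨hfR, hinj⟩ := hf
      have h1 : {𝒯 | IsLozengeTiling R 𝒯 ∧ ∀ i, ({d i, p i (f i)} : Finset _) ∈ 𝒯} =
          {𝒯 | IsLozengeTiling R 𝒯 ∧ Set.range (fun i => ({d i, p i (f i)} : Finset _)) ⊆ 𝒯} := by
        ext 𝒯
        simp [Set.range_subset_iff]
      rw [h1, ncard_setOf_isLozengeTiling_superset]
      · congr 2
        ext t
        simp only [Set.mem_range, exists_exists_eq_and, Finset.mem_insert, Finset.mem_singleton,
          Set.mem_ofPred_eq, Set.mem_union, eq_comm (a := t), exists_or]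
      · rintro _ ⟨i, rfl⟩
        refine ⟨⟨_, _, hadj i (f i), rfl⟩, fun t ht => ?_⟩
        simp only [Finset.mem_insert, Finset.mem_singleton] at ht
        rcases ht with rfl | rfl
        · exact hdR i
        · exact hfR i
      · rintro _ ⟨i, rfl⟩ _ ⟨j, rfl⟩ t hi hj
        have : i = j := by
          simp only [Finset.mem_insert, Finset.mem_singleton] at hi hj
          rcases hi with rfl | rfl
          · rcases hj with h | h
            · exact hd h
            · exact absurd h.symm (hdp _ _ _)
          · rcases hj with h | h
            · exact absurd h (hdp _ _ _)
            · exact hinj h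
        rw [this]
    -- A choice that leaves the region or uses a partner twice extends to no tiling.
    · rw [Set.ncard_eq_zero (hS f)]
      refine Set.eq_empty_of_forall_notMem fun 𝒯 ⟨h, h𝒯⟩ => hf ⟨fun i => ?_, fun i j hij => ?_⟩
      · exact (h.1 _ (h𝒯 i)).2 _ (by simp)
      · have e := h.eq_of_mem (h𝒯 i) (h𝒯 j) (t := p i (f i)) (by simp)
          (by simp only at hij; simp [hij])
        have : d i ∈ ({d j, p j (f j)} : Finset _) := by rw [← e]; simp
        simp only [Finset.mem_insert, Finset.mem_singleton] at this
        exact hd (this.resolve_right fun h => hdp j i (f j) h.symm)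
  · intro f _ g _ hfg
    refine Finset.disjoint_left.2 fun 𝒯 hf hg => hfg ?_
    simp only [Set.Finite.mem_toFinset, Set.mem_ofPred_eq] at hf hg
    exact huni 𝒯 hf.1 f g hf.2 hg.2

open Classical in
/-- Removing forced lozenges: each cell of `C` has the only possible partner `q c`. -/
theorem tilingNumber_eq_of_forced {R C : Set TriCell} (hC : C ⊆ R) (q : TriCell → TriCell)
    (hq : Function.Injective q) (hadj : ∀ c ∈ C, c.SharesEdge (q c))
    (hpart : ∀ c ∈ C, ∀ s ∈ R, c.SharesEdge s → s = q c) (hqC : ∀ c ∈ C, q c ∉ C) :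
    tilingNumber R = if ∀ c ∈ C, q c ∈ R then tilingNumber (R \ (C ∪ q '' C)) else 0 := by
  have hmem : ∀ 𝒯, IsLozengeTiling R 𝒯 → ∀ c ∈ C, ({c, q c} : Finset _) ∈ 𝒯 := by
    intro 𝒯 h c hc
    obtain ⟨L, ⟨hL, hcL⟩, -⟩ := h.2 c (hC hc)
    obtain ⟨s, hs, rfl⟩ := (h.1 L hL).1.exists_partner hcL
    rwa [← hpart c hc s ((h.1 _ hL).2 s (by simp)) hs]
  split_ifs with hqR
  · have h1 : {𝒯 | IsLozengeTiling R 𝒯} =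
        {𝒯 | IsLozengeTiling R 𝒯 ∧ (fun c => ({c, q c} : Finset _)) '' C ⊆ 𝒯} := by
      ext 𝒯
      simp only [Set.mem_ofPred_eq, Set.image_subset_iff, iff_self_and]
      exact fun h c hc => hmem 𝒯 h c hc
    rw [tilingNumber, h1, ncard_setOf_isLozengeTiling_superset]
    · congr 2
      ext t
      simp only [Set.mem_image, exists_exists_and_eq_and, Finset.mem_insert, Finset.mem_singleton,
        Set.mem_ofPred_eq, Set.mem_union]
      constructor
      · rintro ⟨c, hc, rfl | rfl⟩
        · exact Or.inl hc
        · exact Or.inr ⟨c, hc, rfl⟩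
      · rintro (hc | ⟨c, hc, rfl⟩)
        · exact ⟨t, hc, Or.inl rfl⟩
        · exact ⟨c, hc, Or.inr rfl⟩
    · rintro _ ⟨c, hc, rfl⟩
      refine ⟨⟨_, _, hadj c hc, rfl⟩, fun t ht => ?_⟩
      simp only [Finset.mem_insert, Finset.mem_singleton] at ht
      rcases ht with rfl | rfl
      · exact hC hc
      · exact hqR c hc
    · rintro _ ⟨c, hc, rfl⟩ _ ⟨c', hc', rfl⟩ t h h'
      have : c = c' := by
        simp only [Finset.mem_insert, Finset.mem_singleton] at h h'
        rcases h with rfl | rfl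
        · rcases h' with h | h
          · exact h
          · exact absurd (h ▸ hc) (hqC _ hc')
        · rcases h' with h | h
          · exact absurd (h ▸ hc') (hqC _ hc)
          · exact hq h
      rw [this]
  · rw [tilingNumber, ← Set.ncard_empty (Set (Finset TriCell))]
    congr 1
    refine Set.eq_empty_of_forall_notMem fun 𝒯 h => hqR fun c hc => ?_
    exact (h.1 _ (hmem 𝒯 h c hc)).2 _ (by simp)

/-! ### Peeling off a row -/

/-- The part of `R` below the line at height `y`, where only the down-pointing triangles with
position in `A` are kept in the uppermost row. -/
def belowLine (R : Set TriCell) (y : ℤ) (A : Set ℤ) : Set TriCell :=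
  {t | t ∈ R ∧ t.2 < y ∧ (t.2 = y - 1 → Even (t.1 + t.2) → t.1 ∈ A)}

/-- The part of `R` below the line at height `y`, without the down-pointing triangles whose upper
neighbour belongs to `R` and has its position outside `A`. -/
def belowUpCells (R : Set TriCell) (y : ℤ) (A : Set ℤ) : Set TriCell :=
  {t | t ∈ R ∧ t.2 < y ∧ ¬ (t.2 = y - 1 ∧ Even (t.1 + t.2) ∧ (t.1, y) ∈ R ∧ t.1 ∉ A)}

open Classical in
/-- The number of ways to tile the part of `R` below the line at height `y` together with the
up-pointing triangles right above this line whose position is not in `A`. -/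
noncomputable def upCount (R : Set TriCell) (y : ℤ) (A : Set ℤ) : ℕ :=
  if ∀ X, (X, y) ∈ R → Odd (X + y) → X ∉ A → (X, y - 1) ∈ R then tilingNumber (belowUpCells R y A)
  else 0

/-- All positions have the same parity, hence gaps of at least 2: after unit steps two walkers can
meet but cannot have crossed. -/
theorem injective_iff_strictMono_of_steps {n : ℕ} {h k : Fin n → ℤ} {y : ℤ} (hh : StrictMono h)
    (hpar : ∀ i, Even (h i + y)) (hk : ∀ i, k i = h i - 1 ∨ k i = h i + 1) :
    Function.Injective k ↔ StrictMono k := by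
  refine ⟨fun hinj i j hij => ?_, StrictMono.injective⟩
  have h1 := hh hij
  have h2 : k i ≠ k j := fun h => hij.ne (hinj h)
  have h3 := hpar i
  have h4 := hpar j
  have h5 := hk i
  have h6 := hk j
  simp only [Int.even_iff] at h3 h4
  omega

/-- The step to the left or to the right chosen by a Boolean. -/
def boolStep (e : Bool) : ℤ := if e then 1 else -1

theorem boolStep_eq (e : Bool) : boolStep e = -1 ∨ boolStep e = 1 := by cases e <;> simp [boolStep]

open Classical in
-- The uppermost down-pointing cells have lost their upper neighbours, so each takes its left or
-- right one. This uses up all down-pointing cells of the row, and the remaining up-pointing cells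
-- are forced to pair downwards.
theorem tilingNumber_belowLine_succ {R : Set TriCell} (hR : R.Finite) (y : ℤ) {n : ℕ}
    (h : Fin n → ℤ) (hh : StrictMono h) (hhR : ∀ i, (h i, y) ∈ R) (hpar : ∀ i, Even (h i + y)) :
    tilingNumber (belowLine R (y + 1) (Set.range h)) = ∑ e : Fin n → Bool,
      if (∀ i, (h i + boolStep (e i), y) ∈ R) ∧ StrictMono (fun i => h i + boolStep (e i)) then
        upCount R y (Set.range fun i => h i + boolStep (e i)) else 0 := by
  have hodd : ∀ i e, Odd (h i + boolStep e + y) := fun i e => by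
    have := hpar i
    rcases boolStep_eq e with h | h <;> simp only [h, Int.even_iff, Int.odd_iff] at * <;> omega
  have hmem : ∀ i e, (h i + boolStep e, y) ∈ belowLine R (y + 1) (Set.range h) ↔
      (h i + boolStep e, y) ∈ R := fun i e => by
    have := Int.not_even_iff_odd.2 (hodd i e)
    simp [belowLine, this]
  rw [tilingNumber_eq_sum_partners (ι := Fin n) (α := Bool) (hR.subset fun t ht => ht.1)
    (fun i => (h i, y)) (fun i e => (h i + boolStep e, y))]
  · refine Finset.sum_congr rfl fun e _ => ?_
    have hinj : Function.Injective (fun i => ((h i + boolStep (e i), y) : TriCell)) ↔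
        StrictMono (fun i => h i + boolStep (e i)) := by
      rw [← injective_iff_strictMono_of_steps hh hpar fun i => by
        rcases boolStep_eq (e i) with h | h <;> simp [h, sub_eq_add_neg]]
      exact ⟨fun H i j hij => H (by simpa using hij), fun H i j hij => H (by simpa using hij)⟩
    simp only [hmem, hinj]
    split_ifs with hc
    · set A := Set.range fun i => h i + boolStep (e i) with hA
      set Q := belowLine R (y + 1) (Set.range h) \ ((Set.range fun i => ((h i, y) : TriCell)) ∪
        Set.range fun i => ((h i + boolStep (e i), y) : TriCell)) with hQ
      have hQmem : ∀ X z, (X, z) ∈ Q ↔ (X, z) ∈ R ∧ (z < y ∨ (z = y ∧ Odd (X + y) ∧ X ∉ A)) := by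
        intro X z
        simp only [hQ, hA, belowLine, Set.mem_sdiff, Set.mem_ofPred_eq, Set.mem_union, Set.mem_range,
          Prod.mk.injEq, not_or, not_exists, not_and]
        constructor
        · rintro ⟨⟨h1, h2, h3⟩, h4, h5⟩
          refine ⟨h1, ?_⟩
          rcases (by omega : z < y ∨ z = y) with hz | rfl
          · exact Or.inl hz
          · refine Or.inr ⟨rfl, ?_, fun i hi => h5 i hi rfl⟩
            by_contra hX
            obtain ⟨i, hi⟩ := h3 (by ring) (Int.not_odd_iff_even.1 hX)
            exact h4 i hi rfl
        · rintro ⟨h1, h2 | ⟨rfl, h2, h3⟩⟩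
          · exact ⟨⟨h1, by omega, by omega⟩, fun i _ hi => by omega, fun i _ hi => by omega⟩
          · refine ⟨⟨h1, by omega, fun _ hX => absurd hX (Int.not_even_iff_odd.2 h2)⟩, ?_, ?_⟩
            · rintro i rfl
              exact absurd (hpar i) (Int.not_even_iff_odd.2 h2)
            · exact fun i hi _ => h3 i hi
      -- The forced cells are the up-pointing ones left in row `y`. If one of them has no cell
      -- below, there is no tiling, in agreement with the default value 0 of `upCount`.
      rw [tilingNumber_eq_of_forced (R := Q) (C := {t | t ∈ Q ∧ t.2 = y}) (fun t ht => ht.1)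
        (fun t => (t.1, t.2 - 1))]
      · rw [upCount]
        have hcond : (∀ c ∈ {t | t ∈ Q ∧ t.2 = y}, (c.1, c.2 - 1) ∈ Q) ↔
            ∀ X, (X, y) ∈ R → Odd (X + y) → X ∉ A → (X, y - 1) ∈ R := by
          constructor
          · intro H X h1 h2 h3
            exact ((hQmem _ _).1 (H (X, y) ⟨(hQmem _ _).2 ⟨h1, Or.inr ⟨rfl, h2, h3⟩⟩, rfl⟩)).1
          · rintro H ⟨X, z⟩ ⟨h1, rfl : z = y⟩
            obtain ⟨h1, h2 | ⟨-, h2, h3⟩⟩ := (hQmem _ _).1 h1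
            · omega
            · exact (hQmem _ _).2 ⟨H X h1 h2 h3, Or.inl (by simp)⟩
        simp only [hcond]
        split_ifs with hcd
        · congr 1
          ext ⟨X, z⟩
          simp only [Set.mem_sdiff, hQmem, Set.mem_union, Set.mem_ofPred_eq, Set.mem_image,
            Prod.mk.injEq, Prod.exists, belowUpCells, not_or, not_and, not_exists]
          constructor
          · rintro ⟨⟨h1, h2⟩, h3, h4⟩
            have hz : z < y := by
              rcases h2 with h2 | h2
              · exact h2
              · exact absurd h2.1 (h3 ⟨h1, Or.inr h2⟩)
            refine ⟨h1, hz, fun h5 h6 h7 h8 => h4 X y ⟨⟨h7, Or.inr ⟨rfl, ?_, h8⟩⟩, rfl⟩ rfl h5.symm⟩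
            simp only [Int.even_iff, Int.odd_iff] at *; omega
          · rintro ⟨h1, h2, h3⟩
            refine ⟨⟨h1, Or.inl h2⟩, fun _ => h2.ne, ?_⟩
            rintro X' z' ⟨⟨h4, h5⟩, rfl⟩ rfl rfl
            rcases h5 with h5 | ⟨-, h5, h6⟩
            · omega
            · refine h3 rfl ?_ h4 h6
              simp only [Int.even_iff, Int.odd_iff] at *; omega
        · rfl
      · rintro ⟨X, z⟩ ⟨X', z'⟩ hXX
        simpa using hXX
      · rintro ⟨X, z⟩ ⟨h1, rfl : z = y⟩
        obtain ⟨-, h2 | ⟨-, h2, -⟩⟩ := (hQmem _ _).1 h1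
        · omega
        · exact TriCell.sharesEdge_below h2
      · rintro ⟨X, z⟩ ⟨h1, rfl : z = y⟩ ⟨X', z'⟩ h2 h3
        obtain ⟨-, h4 | ⟨-, h4, -⟩⟩ := (hQmem _ _).1 h1
        · omega
        obtain ⟨-, h5⟩ := (hQmem _ _).1 h2
        have h6 : z' = z → Odd (X' + z) := fun h => by
          rcases h5 with h5 | h5
          · omega
          · exact h5.2.1
        have h7 := TriCell.sharesEdge_cases h3
        simp only [Int.even_iff, Int.odd_iff, Prod.mk.injEq] at *
        omega
      · rintro ⟨X, z⟩ ⟨h1, rfl : z = y⟩ ⟨-, h2⟩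
        simp at h2
    · rfl
  · exact fun i j hij => hh.injective (by simpa using hij)
  · exact fun i => ⟨hhR i, by simp, fun _ _ => ⟨i, rfl⟩⟩
  · intro i e e'
    cases e <;> cases e' <;> simp [boolStep]
  · intro i e
    cases e
    · exact TriCell.sharesEdge_left _ _
    · exact TriCell.sharesEdge_right _ _
  · rintro i ⟨X, z⟩ ⟨-, h1, -⟩ h2
    have h3 := TriCell.sharesEdge_cases h2
    have h4 := hpar i
    simp only [Int.even_iff, Int.odd_iff] at *
    rcases (by omega : z = y ∧ (X = h i - 1 ∨ X = h i + 1)) with ⟨rfl, rfl | rfl⟩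
    · exact ⟨false, by simp [boolStep, sub_eq_add_neg]⟩
    · exact ⟨true, by simp [boolStep]⟩
  · intro i j e hij
    have h1 := hodd i e
    have h2 := hpar j
    simp only [Prod.mk.injEq, and_true] at hij
    rw [hij] at h1
    exact Int.not_even_iff_odd.2 h1 h2

/-! ### Determinants counting the tilings below a line -/

/-- One step of the simple walk on the integers. -/
def walkStep (f : ℤ → ℚ) : ℤ → ℚ := fun X => f (X - 1) + f (X + 1)

open Matrix

/-- Each row of the determinant is a sum over a left and a right step, and multilinearity gives a
sum over all choices of steps. A collision produces two equal rows, and by `hv` a step out of the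
region produces a zero row, so exactly the admissible choices survive. -/
theorem tilingNumber_belowLine_succ_eq_det {R : Set TriCell} (hR : R.Finite) (y : ℤ) {n : ℕ}
    (φ : Fin n → ℤ → ℚ)
    (H : ∀ k : Fin n → ℤ, StrictMono k → (∀ i, (k i, y) ∈ R ∧ Odd (k i + y)) →
      (upCount R y (Set.range k) : ℚ) = det (of fun i j => φ j (k i)))
    (hv : ∀ X, Odd (X + y) → ((X + 1, y) ∈ R ∨ (X - 1, y) ∈ R) → (X, y) ∉ R → ∀ j, φ j X = 0)
    (h : Fin n → ℤ) (hh : StrictMono h) (hhR : ∀ i, (h i, y) ∈ R ∧ Even (h i + y)) :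
    (tilingNumber (belowLine R (y + 1) (Set.range h)) : ℚ) =
      det (of fun i j => walkStep (φ j) (h i)) := by
  classical
  have hodd : ∀ i e, Odd (h i + boolStep e + y) := fun i e => by
    have := (hhR i).2
    rcases boolStep_eq e with h | h <;> simp only [h, Int.even_iff, Int.odd_iff] at * <;> omega
  have h1 : (of fun i j => walkStep (φ j) (h i) : Matrix (Fin n) (Fin n) ℚ) =
      fun i => ∑ e : Bool, fun j => φ j (h i + boolStep e) := by
    funext i j
    simp [walkStep, boolStep, sub_eq_add_neg, add_comm]
  rw [tilingNumber_belowLine_succ hR y h hh (fun i => (hhR i).1) (fun i => (hhR i).2), h1]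
  change _ = detRowAlternating.toMultilinearMap (fun i => ∑ e : Bool, fun j => φ j (h i + boolStep e))
  rw [MultilinearMap.map_sum]
  push_cast
  refine Finset.sum_congr rfl fun e _ => ?_
  change _ = det (of fun i j => φ j (h i + boolStep (e i)))
  split_ifs with hc
  · exact H _ hc.2 fun i => ⟨hc.1 i, hodd _ _⟩
  · rw [not_and_or] at hc
    symm
    rcases hc with hc | hc
    · obtain ⟨i, hi⟩ := not_forall.1 hc
      refine det_eq_zero_of_row_eq_zero i fun j => hv _ (hodd _ _) ?_ hi j
      rcases boolStep_eq (e i) with h | h <;> simp [h, (hhR i).1]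
    · rw [← injective_iff_strictMono_of_steps hh (fun i => (hhR i).2) fun i => by
        rcases boolStep_eq (e i) with h | h <;> simp [h, sub_eq_add_neg],
        Function.not_injective_iff] at hc
      obtain ⟨i, j, hij, hne⟩ := hc
      exact det_zero_of_row_eq hne (funext fun l => by simp [hij])

/-- If the two cells on either side of the line are always present together, no walk starts or ends
at this line. -/
theorem upCount_eq_tilingNumber_belowLine {R : Set TriCell} {y : ℤ}
    (h : ∀ X, Odd (X + y) → ((X, y) ∈ R ↔ (X, y - 1) ∈ R)) (A : Set ℤ) :
    upCount R y A = tilingNumber (belowLine R y A) := by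
  rw [upCount, if_pos fun X h1 h2 _ => (h X h2).1 h1]
  congr 1
  ext ⟨X, z⟩
  simp only [belowUpCells, belowLine, Set.mem_ofPred_eq]
  refine and_congr_right fun h1 => and_congr_right fun _ => ?_
  constructor
  · rintro h2 rfl h3
    by_contra h4
    refine h2 ⟨rfl, h3, (h X ?_).2 h1, h4⟩
    simp only [Int.even_iff, Int.odd_iff] at *
    omega
  · rintro h2 ⟨rfl, h3, h4, h5⟩
    exact h5 (h2 rfl h3)

/-! ### Lines on which new walks start -/

theorem le_of_strictMono_of_odd {n : ℕ} {h : Fin n → ℤ} (hh : StrictMono h) {t y : ℤ}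
    (ht : Odd (t + y)) (hodd : ∀ i, Odd (h i + y)) (hle : ∀ i, t ≤ h i) (i : Fin n) :
    t + 2 * (i : ℕ) ≤ h i := by
  obtain ⟨v, hv⟩ := i
  induction v with
  | zero => simpa using hle _
  | succ v ih =>
    have h1 := ih (by omega)
    have h2 : h ⟨v, by omega⟩ < h ⟨v + 1, hv⟩ := hh (by simp [Fin.lt_def])
    have h3 := hodd ⟨v, by omega⟩
    have h4 := hodd ⟨v + 1, hv⟩
    simp only [Int.odd_iff] at *
    push_cast at *
    omega

theorem eq_of_subset_range {n a : ℕ} {h : Fin n → ℤ} {t : ℤ}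
    (hle : ∀ i : Fin n, t + 2 * (i : ℕ) ≤ h i) (hT : ∀ j < a, t + 2 * (j : ℕ) ∈ Set.range h) (i : Fin n)
    (hi : (i : ℕ) < a) : h i = t + 2 * (i : ℕ) := by
  obtain ⟨v, hv⟩ := i
  induction v using Nat.strong_induction_on with
  | _ v ih =>
    obtain ⟨⟨k, hk⟩, hk'⟩ := hT v hi
    have h1 := hle ⟨k, hk⟩
    simp only at h1 hi ⊢
    rcases lt_trichotomy k v with hkv | rfl | hkv
    · have := ih k hkv hk (by simp only; omega)
      simp only at this
      omega
    · exact hk'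
    · omega

/-- The first `a` functions are point masses at the first `a` positions: the matrix has an identity
block with zeros below it. -/
theorem det_of_initial_block {a m : ℕ} {t : ℤ} (ψ : Fin (a + m) → ℤ → ℚ)
    (hψ : ∀ (j : Fin a) X, t ≤ X → ψ (Fin.castAdd m j) X = if X = t + 2 * (j : ℕ) then 1 else 0)
    (h : Fin (a + m) → ℤ) (h1 : ∀ i : Fin a, h (Fin.castAdd m i) = t + 2 * (i : ℕ))
    (h2 : ∀ i : Fin m, t + 2 * a ≤ h (Fin.natAdd a i)) :
    det (of fun i j => ψ j (h i)) =
      det (of fun i j : Fin m => ψ (Fin.natAdd a j) (h (Fin.natAdd a i))) := by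
  rw [← det_submatrix_equiv_self finSumFinEquiv]
  have : (of fun i j => ψ j (h i)).submatrix finSumFinEquiv finSumFinEquiv =
      fromBlocks (1 : Matrix (Fin a) (Fin a) ℚ) (of fun i j => ψ (Fin.natAdd a j) (h (Fin.castAdd m i)))
      0 (of fun i j : Fin m => ψ (Fin.natAdd a j) (h (Fin.natAdd a i))) := by
    ext (i | i) (j | j)
    · simp only [submatrix_apply, finSumFinEquiv_apply_left, of_apply, fromBlocks_apply₁₁]
      rw [hψ j _ (by rw [h1]; omega), h1, one_apply]
      congr 1
      simp [Fin.ext_iff]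
    · simp
    · simp only [submatrix_apply, finSumFinEquiv_apply_left, finSumFinEquiv_apply_right, of_apply,
        fromBlocks_apply₂₁, Matrix.zero_apply]
      have := h2 i
      have := j.2
      rw [hψ j _ (by omega), if_neg (by omega)]
    · simp
  rw [this, det_fromBlocks_zero₂₁, det_one, one_mul]

/-- The `a` up-pointing cells from `t` on have nothing below them, so each must be occupied by a new
walk, while the other `m` walks come from below. If all `a` are occupied, the determinant reduces to
that of the `m` old walks; otherwise both sides vanish. -/
theorem upCount_eq_det_of_new_cells {R : Set TriCell} {y t : ℤ} {a m : ℕ} (ht : Odd (t + y))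
    (hU : ∀ X, Odd (X + y) → (X, y) ∈ R → t ≤ X ∧ ((X, y - 1) ∉ R ↔ X < t + 2 * a))
    (hD : ∀ X, Odd (X + y) → (X, y - 1) ∈ R → (X, y) ∈ R)
    (hT : ∀ j < a, (t + 2 * (j : ℕ), y) ∈ R) (ψ : Fin (a + m) → ℤ → ℚ)
    (hψ : ∀ (j : Fin a) X, t ≤ X → ψ (Fin.castAdd m j) X = if X = t + 2 * (j : ℕ) then 1 else 0)
    (H : ∀ k : Fin m → ℤ, StrictMono k → (∀ i, (k i, y - 1) ∈ R ∧ Odd (k i + y)) →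
      (tilingNumber (belowLine R y (Set.range k)) : ℚ) =
        det (of fun i j => ψ (Fin.natAdd a j) (k i)))
    (h : Fin (a + m) → ℤ) (hh : StrictMono h) (hhR : ∀ i, (h i, y) ∈ R ∧ Odd (h i + y)) :
    (upCount R y (Set.range h) : ℚ) = det (of fun i j => ψ j (h i)) := by
  have hle := le_of_strictMono_of_odd hh ht (fun i => (hhR i).2)
    fun i => (hU _ (hhR i).2 (hhR i).1).1
  have hodd : ∀ j : ℕ, Odd (t + 2 * (j : ℤ) + y) := fun j => by
    simp only [Int.odd_iff] at *; omega
  by_cases hsub : ∀ j < a, t + 2 * (j : ℤ) ∈ Set.range h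
  · have h1 : ∀ i : Fin a, h (Fin.castAdd m i) = t + 2 * (i : ℕ) := fun i =>
      eq_of_subset_range hle hsub (Fin.castAdd m i) i.2
    have h2 : ∀ i : Fin m, t + 2 * a ≤ h (Fin.natAdd a i) := fun i => by
      have := hle (Fin.natAdd a i)
      rw [Fin.val_natAdd] at this
      push_cast at this
      omega
    have h3 : ∀ X, t + 2 * a ≤ X → (X ∈ Set.range h ↔ X ∈ Set.range fun i => h (Fin.natAdd a i)) := by
      intro X hX
      constructor
      · rintro ⟨i, rfl⟩
        refine Fin.addCases (fun i hX => ?_) (fun i _ => ⟨i, rfl⟩) i hX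
        have := i.2
        rw [h1] at hX
        omega
      · rintro ⟨i, rfl⟩
        exact ⟨_, rfl⟩
    rw [det_of_initial_block ψ hψ h h1 h2, ← H (fun i => h (Fin.natAdd a i))]
    · rw [upCount, if_pos]
      · congr 2
        ext ⟨X, z⟩
        simp only [belowUpCells, belowLine, Set.mem_ofPred_eq]
        refine and_congr_right fun hXR => and_congr_right fun _ => ?_
        have hodd' : z = y - 1 → Even (X + z) → Odd (X + y) := by
          rintro rfl he
          simp only [Int.even_iff, Int.odd_iff] at *
          omega
        constructor
        · rintro h4 rfl h5
          have h6 := hD X (hodd' rfl h5) hXR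
          have h7 := (hU X (hodd' rfl h5) h6).2
          rw [← h3 X (by by_contra hlt; exact h7.2 (by omega) hXR)]
          by_contra h8
          exact h4 ⟨rfl, h5, h6, h8⟩
        · rintro h4 ⟨rfl, h5, h6, h7⟩
          have h8 := (hU X (hodd' rfl h5) h6).2
          rw [h3 X (by by_contra hlt; exact h8.2 (by omega) hXR)] at h7
          exact h7 (h4 rfl h5)
      · intro X h4 h5 h6
        by_contra h7
        have h8 := hU X h5 h4
        have h9 := h8.2.1 h7
        refine h6 ?_
        have : X = t + 2 * (((X - t) / 2).toNat : ℕ) := by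
          simp only [Int.odd_iff] at *; omega
        rw [this]
        refine hsub _ ?_
        omega
    · exact fun i j hij => hh (Fin.strictMono_natAdd a hij)
    · refine fun i => ⟨?_, (hhR _).2⟩
      by_contra h4
      have := (hU _ (hhR _).2 (hhR (Fin.natAdd a i)).1).2.1 h4
      have := h2 i
      omega
  · push Not at hsub
    obtain ⟨j, hj, hjh⟩ := hsub
    rw [upCount, if_neg, Nat.cast_zero]
    · symm
      -- The column of the point mass at an unoccupied new cell is zero.
      refine det_eq_zero_of_column_eq_zero (Fin.castAdd m ⟨j, hj⟩) fun i => ?_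
      rw [of_apply, hψ _ _ (hU _ (hhR i).2 (hhR i).1).1, if_neg fun h => hjh ⟨i, h⟩]
    · intro hc
      exact ((hU _ (hodd j) (hT j hj)).2.2 (by omega)) (hc _ (hT j hj) (hodd j) hjh)

/-! ### Walks -/

/-- The walk that starts at `s`. -/
def walkStart (s : ℤ) : ℤ → ℚ := fun X => if X = s then 1 else 0

/-- Twice the odd part of a function. -/
def oddPart (f : ℤ → ℚ) : ℤ → ℚ := fun X => f X - f (-X)

theorem walkStep_iterate_eq_zero_of_lt {f : ℤ → ℚ} {M : ℤ} (h : ∀ X, M < X → f X = 0) (k : ℕ) :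
    ∀ X, M + k < X → walkStep^[k] f X = 0 := by
  induction k with
  | zero => simpa using h
  | succ k ih =>
    intro X hX
    push_cast at hX
    rw [Function.iterate_succ_apply', walkStep, ih _ (by omega), ih _ (by omega), add_zero]

theorem walkStep_iterate_eq_zero_of_gt {f : ℤ → ℚ} {M : ℤ} (h : ∀ X, X < M → f X = 0) (k : ℕ) :
    ∀ X, X < M - k → walkStep^[k] f X = 0 := by
  induction k with
  | zero => simpa using h
  | succ k ih =>
    intro X hX
    push_cast at hX
    rw [Function.iterate_succ_apply', walkStep, ih _ (by omega), ih _ (by omega), add_zero]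

theorem walkStep_iterate_neg {f : ℤ → ℚ} (h : ∀ X, f (-X) = -f X) (k : ℕ) :
    ∀ X, walkStep^[k] f (-X) = -walkStep^[k] f X := by
  induction k with
  | zero => exact h
  | succ k ih =>
    intro X
    have h1 : -X - 1 = -(X + 1) := by ring
    have h2 : -X + 1 = -(X - 1) := by ring
    rw [Function.iterate_succ_apply', walkStep, walkStep, h1, h2, ih, ih]
    ring

/-- The reflection principle: oddness is preserved by the walk and supplies the absorbing wall at 0,
that is, the zigzag side. -/
theorem walkStep_iterate_zero {f : ℤ → ℚ} (h : ∀ X, f (-X) = -f X) (k : ℕ) :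
    walkStep^[k] f 0 = 0 := by
  have := walkStep_iterate_neg h k 0
  rw [neg_zero] at this
  linarith

theorem oddPart_neg (f : ℤ → ℚ) (X : ℤ) : oddPart f (-X) = -oddPart f X := by
  simp [oddPart]

theorem walkStart_of_lt {s X : ℤ} (h : s < X) : walkStart s X = 0 := if_neg h.ne'

theorem walkStart_of_gt {s X : ℤ} (h : X < s) : walkStart s X = 0 := if_neg h.ne

/-- The one-row step is iterated through a strip in which no walk starts or ends (`hord`) and the
walk functions vanish just outside the region (`hv`). Rows `y` to `y + K` are crossed, hence `K + 1`
steps. -/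
theorem tilingNumber_belowLine_add_eq_det {R : Set TriCell} (hR : R.Finite) (y : ℤ) {n : ℕ}
    (φ : Fin n → ℤ → ℚ)
    (H : ∀ k : Fin n → ℤ, StrictMono k → (∀ i, (k i, y) ∈ R ∧ Odd (k i + y)) →
      (upCount R y (Set.range k) : ℚ) = det (of fun i j => φ j (k i))) (K : ℕ)
    (hord : ∀ k < K, ∀ X : ℤ, Odd (X + (y + k + 1)) →
      ((X, y + k + 1) ∈ R ↔ (X, y + k) ∈ R))
    (hv : ∀ k ≤ K, ∀ X : ℤ, Odd (X + (y + k)) → ((X + 1, y + k) ∈ R ∨ (X - 1, y + k) ∈ R) →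
      (X, y + k) ∉ R → ∀ j, walkStep^[k] (φ j) X = 0)
    (h : Fin n → ℤ) (hh : StrictMono h) (hhR : ∀ i, (h i, y + K) ∈ R ∧ Even (h i + (y + K))) :
    (tilingNumber (belowLine R (y + K + 1) (Set.range h)) : ℚ) =
      det (of fun i j => walkStep^[K + 1] (φ j) (h i)) := by
  have key : ∀ k ≤ K, ∀ h : Fin n → ℤ, StrictMono h → (∀ i, (h i, y + k) ∈ R ∧ Odd (h i + (y + k))) →
      (upCount R (y + k) (Set.range h) : ℚ) = det (of fun i j => walkStep^[k] (φ j) (h i)) := by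
    intro k
    induction k with
    | zero => simpa using H
    | succ k ih =>
      intro hk h hh hhR
      push_cast at hhR ⊢
      rw [← add_assoc] at hhR ⊢
      rw [upCount_eq_tilingNumber_belowLine
        fun X hX => by rw [hord k (by omega) X hX, add_sub_cancel_right],
        tilingNumber_belowLine_succ_eq_det hR (y + k) (fun j => walkStep^[k] (φ j))
          (ih (by omega)) (hv k (by omega)) h hh]
      · simp only [Function.iterate_succ_apply']
      · intro i
        refine ⟨(hord k (by omega) _ (hhR i).2).1 (hhR i).1, ?_⟩
        have := (hhR i).2
        simp only [Int.even_iff, Int.odd_iff] at *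
        omega
  rw [tilingNumber_belowLine_succ_eq_det hR (y + K) (fun j => walkStep^[K] (φ j))
    (key K le_rfl) (hv K le_rfl) h hh hhR]
  simp only [Function.iterate_succ_apply']

/-! ### The regions -/

theorem mem_regionB_of_even {x a b c : ℕ} {X y : ℤ} (h : Even (X + y)) :
    (X, y) ∈ regionB x a b c ↔ 1 ≤ X ∧ 0 ≤ X + y ∧ -(b : ℤ) ≤ y ∧ X - y ≤ 2 * x + 2 * b ∧
      X + y ≤ 2 * x + 4 * a + 2 * c ∧ y ≤ 2 * a + 2 * c ∧ (y < X ∨ X + y < 2 ∨ 2 * a < y) := by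
  simp only [regionB, halvedHexagon, downTriangle, Set.mem_sdiff, Set.mem_ofPred_eq,
    TriCell.corners_of_even h, Finset.forall_mem_insert, Finset.mem_singleton, forall_eq]
  omega

theorem mem_regionB_of_odd {x a b c : ℕ} {X y : ℤ} (h : Odd (X + y)) :
    (X, y) ∈ regionB x a b c ↔ 1 ≤ X ∧ 1 ≤ X + y ∧ -(b : ℤ) ≤ y ∧ X - y + 1 ≤ 2 * x + 2 * b ∧
      X + y ≤ 2 * x + 4 * a + 2 * c + 1 ∧ y ≤ 2 * a + 2 * c ∧
      (y < X + 1 ∨ X + y < 3 ∨ 2 * a < y) := by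
  simp only [regionB, halvedHexagon, downTriangle, Set.mem_sdiff, Set.mem_ofPred_eq,
    TriCell.corners_of_odd h, Finset.forall_mem_insert, Finset.mem_singleton, forall_eq]
  omega

theorem mem_regionP_of_even {a c : ℕ} {X y : ℤ} (h : Even (X + y)) :
    (X, y) ∈ regionP c c a ↔ 1 ≤ X ∧ 2 ≤ X - y ∧ 2 - 2 * (c : ℤ) ≤ X + y ∧ 1 - 2 * (c : ℤ) ≤ y ∧
      X - y ≤ 2 * a + 2 * c ∧ X + y ≤ 2 * a ∧ y ≤ 0 := by
  simp only [regionP, Set.mem_ofPred_eq,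
    TriCell.corners_of_even h, Finset.forall_mem_insert, Finset.mem_singleton, forall_eq]
  omega

theorem mem_regionP_of_odd {a c : ℕ} {X y : ℤ} (h : Odd (X + y)) :
    (X, y) ∈ regionP c c a ↔ 1 ≤ X ∧ 1 ≤ X - y ∧ 3 - 2 * (c : ℤ) ≤ X + y ∧ 1 - 2 * (c : ℤ) ≤ y ∧
      X - y + 1 ≤ 2 * a + 2 * c ∧ X + y ≤ 2 * a + 1 ∧ y ≤ 0 := by
  simp only [regionP, Set.mem_ofPred_eq,
    TriCell.corners_of_odd h, Finset.forall_mem_insert, Finset.mem_singleton, forall_eq]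
  omega

theorem finite_regionB (x a b c : ℕ) : (regionB x a b c).Finite := by
  refine (Set.finite_Icc ((1, -b) : ℤ × ℤ) (2 * x + 2 * b + 2 * a + 2 * c, 2 * a + 2 * c)).subset ?_
  rintro ⟨X, y⟩ h
  simp only [Set.mem_Icc, Prod.mk_le_mk]
  rcases Int.even_or_odd (X + y) with e | e
  · rw [mem_regionB_of_even e] at h; omega
  · rw [mem_regionB_of_odd e] at h; omega

theorem finite_regionP (a c : ℕ) : (regionP c c a).Finite := by
  refine (Set.finite_Icc ((1, 1 - 2 * c) : ℤ × ℤ) (2 * a + 2 * c, 0)).subset ?_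
  rintro ⟨X, y⟩ h
  simp only [Set.mem_Icc, Prod.mk_le_mk]
  rcases Int.even_or_odd (X + y) with e | e
  · rw [mem_regionP_of_even e] at h; omega
  · rw [mem_regionP_of_odd e] at h; omega

/-! ### Source functions and the determinants of the two regions -/

/-- The numbers of walks from the southern side and from the top of the removed triangle, extended
to odd functions. -/
def sourceWalk (a x b : ℕ) : Fin (a + x) → ℤ → ℚ :=
  Fin.addCases (fun j => oddPart (walkStart (2 + 2 * (j : ℕ))))
    fun j => oddPart (walkStep^[2 * a + b + 1] (walkStart (b + 1 + 2 * (j : ℕ))))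

theorem sourceWalk_neg (a x b : ℕ) (j : Fin (a + x)) (X : ℤ) :
    sourceWalk a x b j (-X) = -sourceWalk a x b j X := by
  refine Fin.addCases (fun j => ?_) (fun j => ?_) j <;> simp [sourceWalk, oddPart_neg]

theorem sourceWalk_castAdd (a x b : ℕ) (j : Fin a) {X : ℤ} (hX : 2 ≤ X) :
    sourceWalk a x b (Fin.castAdd x j) X = if X = 2 + 2 * (j : ℕ) then 1 else 0 := by
  rw [sourceWalk, Fin.addCases_left, oddPart, walkStart_of_gt (X := -X) (by omega), sub_zero]
  rfl

/-- The matrix whose determinant counts the tilings. -/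
def tilingMatrix (a x b c : ℕ) : Matrix (Fin (a + x)) (Fin (a + x)) ℚ :=
  of fun i j => walkStep^[2 * c] (sourceWalk a x b j) (2 + 2 * (i : ℕ))

theorem tilingNumber_regionP (a b c : ℕ) :
    (tilingNumber (regionP c c a) : ℚ) = det (tilingMatrix a 0 b c) := by
  rcases Nat.eq_zero_or_pos c with rfl | hc
  · have h1 : regionP 0 0 a = ∅ := by
      refine Set.eq_empty_of_forall_notMem fun ⟨X, y⟩ h => ?_
      rcases Int.even_or_odd (X + y) with e | e
      · rw [mem_regionP_of_even e] at h; omega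
      · rw [mem_regionP_of_odd e] at h; omega
    rw [h1, tilingNumber_empty, tilingMatrix]
    have := det_of_initial_block (m := 0) (sourceWalk a 0 b) (t := 2)
      (fun j X hX => sourceWalk_castAdd a 0 b j hX) (fun i => 2 + 2 * (i : ℕ)) (by simp) (by simp)
    simpa using this.symm
  · obtain ⟨K, hK⟩ : ∃ K, 2 * c = K + 1 := ⟨2 * c - 1, by omega⟩
    -- All walks start in the bottom row; `m = 0` because nothing lies below it.
    have h0 := upCount_eq_det_of_new_cells (R := regionP c c a) (y := 1 - 2 * c) (t := 2) (a := a)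
      (m := 0) (by rw [Int.odd_iff]; omega)
      (fun X hX h => by
        have e : Even (X + (1 - 2 * c - 1)) := by
          simp only [Int.even_iff, Int.odd_iff] at *; omega
        rw [mem_regionP_of_even e]
        rw [mem_regionP_of_odd hX] at h
        simp only [Int.odd_iff] at *
        omega)
      (fun X hX h => by
        have e : Even (X + (1 - 2 * c - 1)) := by
          simp only [Int.even_iff, Int.odd_iff] at *; omega
        rw [mem_regionP_of_even e] at h
        omega)
      (fun j hj => by
        rw [mem_regionP_of_odd (by rw [Int.odd_iff]; omega)]
        omega) (sourceWalk a 0 b) (fun j X hX => sourceWalk_castAdd a 0 b j hX)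
      (fun k _ _ => by
        have : belowLine (regionP c c a) (1 - 2 * c) (Set.range k) = ∅ := by
          refine Set.eq_empty_of_forall_notMem fun ⟨X, y⟩ h => ?_
          obtain ⟨h, h1, -⟩ := h
          simp only at h1
          rcases Int.even_or_odd (X + y) with e | e
          · rw [mem_regionP_of_even e] at h; omega
          · rw [mem_regionP_of_odd e] at h; omega
        rw [this, tilingNumber_empty]
        simp)
    have h1 := tilingNumber_belowLine_add_eq_det (finite_regionP a c) _ _ h0 K ?_ ?_
      (fun i => 2 + 2 * (i : ℕ)) ?_ ?_
    · rw [tilingMatrix, hK, ← h1]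
      congr 2
      ext ⟨X, y⟩
      simp only [belowLine, Set.mem_ofPred_eq]
      refine ⟨fun h => ⟨h, ?_, fun hy e => ?_⟩, fun h => h.1⟩
      · rcases Int.even_or_odd (X + y) with e | e
        · rw [mem_regionP_of_even e] at h; omega
        · rw [mem_regionP_of_odd e] at h; omega
      · rw [mem_regionP_of_even e] at h
        rw [Int.even_iff] at e
        exact ⟨⟨((X - 2) / 2).toNat, by omega⟩, by simp only; omega⟩
    · intro k hk X hX
      have e : Even (X + (1 - 2 * c + k)) := by
        simp only [Int.even_iff, Int.odd_iff] at *; omega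
      rw [mem_regionP_of_even e, mem_regionP_of_odd hX]
      simp only [Int.odd_iff] at *
      omega
    · intro k hk X hX h h' j
      have e1 : Even (X + 1 + (1 - 2 * c + k)) := by
        simp only [Int.even_iff, Int.odd_iff] at *; omega
      have e2 : Even (X - 1 + (1 - 2 * c + k)) := by
        simp only [Int.even_iff, Int.odd_iff] at *; omega
      rw [mem_regionP_of_even e1, mem_regionP_of_even e2] at h
      rw [mem_regionP_of_odd hX] at h'
      -- A step can leave the region only at the zigzag wall, where odd functions vanish, or to the
      -- east, beyond the reach of the sources.
      have hX' : X = 0 ∨ 2 * a + k < X := by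
        simp only [Int.odd_iff] at *
        omega
      rcases hX' with rfl | hX'
      · exact walkStep_iterate_zero (sourceWalk_neg a 0 b j) k
      · refine walkStep_iterate_eq_zero_of_lt (fun X hX => ?_) k X hX'
        have := j.2
        rw [show j = Fin.castAdd 0 j from rfl, sourceWalk_castAdd _ _ _ _ (by omega),
          if_neg (by omega)]
    · intro i j hij
      simp only [Fin.lt_def] at hij ⊢
      omega
    · intro i
      have e : Even (2 + 2 * ((i : ℕ) : ℤ) + (1 - 2 * c + K)) := by
        rw [Int.even_iff]; omega
      refine ⟨?_, e⟩
      rw [mem_regionP_of_even e]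
      omega

/-- These are free walks: the sources cannot get past the southwestern and southeastern sides in the
available steps, and a walk arriving to the right of the removed triangle has always been to its
right, since that side has slope one unit per row. Hence no reflection is needed here. -/
theorem tilingNumber_belowLine_regionB (x a b c : ℕ) (k : Fin x → ℤ) (hk : StrictMono k)
    (hkR : ∀ i, (k i, 2 * (a : ℤ)) ∈ regionB x a b c ∧ Even (k i + 2 * a)) :
    (tilingNumber (belowLine (regionB x a b c) (2 * a + 1) (Set.range k)) : ℚ) =
      det (of fun i j : Fin x => walkStep^[2 * a + b + 1] (walkStart (b + 1 + 2 * (j : ℕ))) (k i)) := by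
  have h0 := upCount_eq_det_of_new_cells (R := regionB x a b c) (y := -b) (t := b + 1) (a := x)
    (m := 0) (by rw [Int.odd_iff]; omega)
    (fun X hX h => by
      have e : Even (X + (-b - 1)) := by
        simp only [Int.even_iff, Int.odd_iff] at *; omega
      rw [mem_regionB_of_even e]
      rw [mem_regionB_of_odd hX] at h
      simp only [Int.odd_iff] at *
      omega)
    (fun X hX h => by
      have e : Even (X + (-b - 1)) := by
        simp only [Int.even_iff, Int.odd_iff] at *; omega
      rw [mem_regionB_of_even e] at h
      omega)
    (fun j hj => by
      rw [mem_regionB_of_odd (by rw [Int.odd_iff]; omega)]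
      omega) (fun j => walkStart (b + 1 + 2 * (j : ℕ))) (fun j X _ => rfl)
    (fun k _ _ => by
      have : belowLine (regionB x a b c) (-b) (Set.range k) = ∅ := by
        refine Set.eq_empty_of_forall_notMem fun ⟨X, y⟩ h => ?_
        obtain ⟨h, h1, -⟩ := h
        simp only at h1
        rcases Int.even_or_odd (X + y) with e | e
        · rw [mem_regionB_of_even e] at h; omega
        · rw [mem_regionB_of_odd e] at h; omega
      rw [this, tilingNumber_empty]
      simp)
  have hy : -(b : ℤ) + (2 * a + b : ℕ) = 2 * a := by push_cast; ring
  have h1 := tilingNumber_belowLine_add_eq_det (finite_regionB x a b c) _ _ h0 (2 * a + b) ?_ ?_ k hk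
    (by rw [hy]; exact hkR)
  · rw [hy] at h1
    exact h1
  · intro k hk X hX
    have e : Even (X + (-b + k)) := by
      simp only [Int.even_iff, Int.odd_iff] at *; omega
    rw [mem_regionB_of_even e, mem_regionB_of_odd hX]
    simp only [Int.odd_iff] at *
    omega
  · intro k hk X hX h h' j
    have e1 : Even (X + 1 + (-b + k)) := by
      simp only [Int.even_iff, Int.odd_iff] at *; omega
    have e2 : Even (X - 1 + (-b + k)) := by
      simp only [Int.even_iff, Int.odd_iff] at *; omega
    rw [mem_regionB_of_even e1, mem_regionB_of_even e2] at h
    rw [mem_regionB_of_odd hX] at h'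
    have hX' : X < b + 1 - k ∨ b + 2 * x - 1 + k < X := by
      simp only [Int.odd_iff] at *
      omega
    have := j.2
    rcases hX' with hX' | hX'
    · exact walkStep_iterate_eq_zero_of_gt (M := b + 1 + 2 * (j : ℕ))
        (fun X hX => walkStart_of_gt hX) k X (by omega)
    · exact walkStep_iterate_eq_zero_of_lt (M := b + 1 + 2 * (j : ℕ))
        (fun X hX => walkStart_of_lt hX) k X (by omega)

/-- The mirror term is invisible here: starting at `b + 1` or further right, `2a + b + 1` steps
cannot lead to the left of `-2a`. -/
theorem sourceWalk_natAdd (a x b : ℕ) (j : Fin x) {X : ℤ} (hX : 2 * a < X) :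
    sourceWalk a x b (Fin.natAdd a j) X =
      walkStep^[2 * a + b + 1] (walkStart (b + 1 + 2 * (j : ℕ))) X := by
  rw [sourceWalk, Fin.addCases_right, oddPart,
    walkStep_iterate_eq_zero_of_gt (M := b + 1 + 2 * (j : ℕ))
      (fun X hX => walkStart_of_gt hX) _ (-X) (by push_cast; omega), sub_zero]

theorem sourceWalk_eq_zero (a x b : ℕ) (j : Fin (a + x)) {X : ℤ} (hX : 2 * b + 2 * x + 2 * a < X) :
    sourceWalk a x b j X = 0 := by
  refine Fin.addCases (fun j => ?_) (fun j => ?_) j <;> have := j.2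
  · rw [sourceWalk_castAdd _ _ _ _ (by omega), if_neg (by omega)]
  · rw [sourceWalk_natAdd _ _ _ _ (by omega)]
    exact walkStep_iterate_eq_zero_of_lt (M := b + 1 + 2 * (j : ℕ))
        (fun X hX => walkStart_of_lt hX) _ X (by push_cast; omega)

theorem tilingNumber_regionB (x a b c : ℕ) :
    (tilingNumber (regionB x a b c) : ℚ) = det (tilingMatrix a x b c) := by
  rcases Nat.eq_zero_or_pos c with rfl | hc
  -- With no rows above the triangle, the `x` walks end on the northern side to the right of it, and
  -- the `a` short walks contribute an identity block.
  · have h1 := tilingNumber_belowLine_regionB x a b 0 (fun i => 2 + 2 * ((Fin.natAdd a i : ℕ) : ℤ))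
      (fun i j hij => by
        simp only [Fin.lt_def, Fin.val_natAdd] at hij ⊢
        push_cast
        omega)
      (fun i => by
        have e : Even (2 + 2 * ((Fin.natAdd a i : ℕ) : ℤ) + 2 * a) := by rw [Int.even_iff]; omega
        refine ⟨?_, e⟩
        rw [mem_regionB_of_even e, Fin.val_natAdd]
        push_cast
        omega)
    have h2 := det_of_initial_block (sourceWalk a x b) (t := 2)
      (fun j X hX => sourceWalk_castAdd a x b j hX) (fun i => 2 + 2 * (i : ℕ)) (by simp)
      (by simp only [Fin.val_natAdd]; intro i; push_cast; omega)
    have h3 : det (tilingMatrix a x b 0) = det (of fun i j => sourceWalk a x b j (2 + 2 * (i : ℕ))) :=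
      rfl
    have h4 : ∀ i j : Fin x, sourceWalk a x b (Fin.natAdd a j) (2 + 2 * ((Fin.natAdd a i : ℕ) : ℤ)) =
        walkStep^[2 * a + b + 1] (walkStart (b + 1 + 2 * (j : ℕ)))
          (2 + 2 * ((Fin.natAdd a i : ℕ) : ℤ)) := fun i j =>
      sourceWalk_natAdd a x b j (by rw [Fin.val_natAdd]; push_cast; omega)
    rw [h3, h2]
    simp only [h4]
    rw [← h1]
    congr 2
    ext ⟨X, y⟩
    simp only [belowLine, Set.mem_ofPred_eq]
    refine ⟨fun h => ⟨h, ?_, fun hy e => ?_⟩, fun h => h.1⟩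
    · rcases Int.even_or_odd (X + y) with e | e
      · rw [mem_regionB_of_even e] at h; omega
      · rw [mem_regionB_of_odd e] at h; omega
    · rw [mem_regionB_of_even e] at h
      rw [Int.even_iff] at e
      exact ⟨⟨((X - 2) / 2).toNat - a, by omega⟩, by simp only [Fin.val_natAdd]; push_cast; omega⟩
  · obtain ⟨K, hK⟩ : ∃ K, 2 * c = K + 1 := ⟨2 * c - 1, by omega⟩
    -- On the top of the removed triangle `a` new walks join the `x` walks from the south.
    have h0 := upCount_eq_det_of_new_cells (R := regionB x a b c) (y := 2 * a + 1) (t := 2) (a := a)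
      (m := x) (by rw [Int.odd_iff]; omega)
      (fun X hX h => by
        have e : Even (X + (2 * a + 1 - 1)) := by
          simp only [Int.even_iff, Int.odd_iff] at *; omega
        rw [mem_regionB_of_even e]
        rw [mem_regionB_of_odd hX] at h
        simp only [Int.odd_iff] at *
        omega)
      (fun X hX h => by
        have e : Even (X + (2 * a + 1 - 1)) := by
          simp only [Int.even_iff, Int.odd_iff] at *; omega
        rw [mem_regionB_of_even e] at h
        rw [mem_regionB_of_odd hX]
        simp only [Int.odd_iff] at *
        omega)
      (fun j hj => by
        rw [mem_regionB_of_odd (by rw [Int.odd_iff]; omega)]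
        omega) (sourceWalk a x b) (fun j X hX => sourceWalk_castAdd a x b j hX)
      (fun k hk hkR => by
        have e : ∀ i, Even (k i + 2 * a) := fun i => by
          have := (hkR i).2
          simp only [Int.even_iff, Int.odd_iff] at *; omega
        rw [add_sub_cancel_right] at hkR
        have h4 : ∀ i j : Fin x, sourceWalk a x b (Fin.natAdd a j) (k i) =
            walkStep^[2 * a + b + 1] (walkStart (b + 1 + 2 * (j : ℕ))) (k i) := fun i j =>
          sourceWalk_natAdd a x b j (by
            have := (hkR i).1
            rw [mem_regionB_of_even (e i)] at this
            omega)
        simp only [h4]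
        exact tilingNumber_belowLine_regionB x a b c k hk fun i => ⟨(hkR i).1, e i⟩)
    have h1 := tilingNumber_belowLine_add_eq_det (finite_regionB x a b c) _ _ h0 K ?_ ?_
      (fun i => 2 + 2 * (i : ℕ)) ?_ ?_
    · rw [tilingMatrix, hK, ← h1]
      congr 2
      ext ⟨X, y⟩
      simp only [belowLine, Set.mem_ofPred_eq]
      refine ⟨fun h => ⟨h, ?_, fun hy e => ?_⟩, fun h => h.1⟩
      · rcases Int.even_or_odd (X + y) with e | e
        · rw [mem_regionB_of_even e] at h; omega
        · rw [mem_regionB_of_odd e] at h; omega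
      · rw [mem_regionB_of_even e] at h
        rw [Int.even_iff] at e
        exact ⟨⟨((X - 2) / 2).toNat, by omega⟩, by simp only; omega⟩
    · intro k hk X hX
      have e : Even (X + (2 * a + 1 + k)) := by
        simp only [Int.even_iff, Int.odd_iff] at *; omega
      rw [mem_regionB_of_even e, mem_regionB_of_odd hX]
      simp only [Int.odd_iff] at *
      omega
    · intro k hk X hX h h' j
      have e1 : Even (X + 1 + (2 * a + 1 + k)) := by
        simp only [Int.even_iff, Int.odd_iff] at *; omega
      have e2 : Even (X - 1 + (2 * a + 1 + k)) := by
        simp only [Int.even_iff, Int.odd_iff] at *; omega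
      rw [mem_regionB_of_even e1, mem_regionB_of_even e2] at h
      rw [mem_regionB_of_odd hX] at h'
      have hX' : X = 0 ∨ 2 * b + 2 * x + 2 * a + k < X := by
        simp only [Int.odd_iff] at *
        omega
      rcases hX' with rfl | hX'
      · exact walkStep_iterate_zero (sourceWalk_neg a x b j) k
      · exact walkStep_iterate_eq_zero_of_lt (fun X hX => sourceWalk_eq_zero a x b j hX) k X hX'
    · intro i j hij
      simp only [Fin.lt_def] at hij ⊢
      omega
    · intro i
      have e : Even (2 + 2 * ((i : ℕ) : ℤ) + (2 * a + 1 + K)) := by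
        rw [Int.even_iff]; omega
      refine ⟨?_, e⟩
      rw [mem_regionB_of_even e]
      omega

/-! ### Binomial coefficients with integer arguments -/

/-- The reciprocal of `z!`, which is zero for negative `z`. -/
def invFact (z : ℤ) : ℚ := if 0 ≤ z then ((z.toNat.factorial : ℚ))⁻¹ else 0

theorem invFact_natCast (n : ℕ) : invFact n = (n.factorial : ℚ)⁻¹ := by simp [invFact]

theorem invFact_of_neg {z : ℤ} (h : z < 0) : invFact z = 0 := if_neg (by omega)

/-- The value 0 at negative integers is what makes this hold for every `z`, so later identities need
no range conditions. -/
theorem invFact_sub_one (z : ℤ) : invFact (z - 1) = z * invFact z := by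
  rcases lt_trichotomy z 0 with h | rfl | h
  · rw [invFact_of_neg h, invFact_of_neg (by omega), mul_zero]
  · simp [invFact]
  · obtain ⟨n, rfl⟩ : ∃ n : ℕ, z = n + 1 := ⟨(z - 1).toNat, by omega⟩
    rw [add_sub_cancel_right, invFact_natCast]
    have h2 := invFact_natCast (n + 1)
    push_cast at h2
    rw [h2, Nat.factorial_succ]
    have h3 : (n.factorial : ℚ) ≠ 0 := by positivity
    push_cast
    field_simp

/-- The binomial coefficient for integer lower argument. -/
def intChoose (N : ℕ) (k : ℤ) : ℚ := N.factorial * invFact k * invFact (N - k)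

theorem intChoose_succ (N : ℕ) (k : ℤ) :
    intChoose (N + 1) k = intChoose N k + intChoose N (k - 1) := by
  have h1 := invFact_sub_one k
  have h2 := invFact_sub_one (N + 1 - k)
  have h3 : (N : ℤ) - (k - 1) = N + 1 - k := by ring
  have h4 : (N : ℤ) + 1 - k - 1 = N - k := by ring
  rw [h4] at h2
  simp only [intChoose, h3, h1, h2, Nat.factorial_succ]
  push_cast
  ring

theorem intChoose_zero (k : ℤ) : intChoose 0 k = if k = 0 then 1 else 0 := by
  rw [intChoose]
  rcases lt_trichotomy k 0 with h | rfl | h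
  · rw [invFact_of_neg h, if_neg h.ne]; simp
  · simp [invFact]
  · rw [invFact_of_neg (z := _ - k) (by simpa using h), if_neg h.ne']; simp

theorem walkStep_iterate_walkStart (s : ℤ) (N : ℕ) (k : ℤ) :
    walkStep^[N] (walkStart s) (s - N + 2 * k) = intChoose N k := by
  induction N generalizing k with
  | zero => simp [walkStart, intChoose_zero]
  | succ N ih =>
    have h1 : s - (N + 1 : ℕ) + 2 * k - 1 = s - N + 2 * (k - 1) := by push_cast; ring
    have h2 : s - (N + 1 : ℕ) + 2 * k + 1 = s - N + 2 * k := by push_cast; ring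
    rw [Function.iterate_succ_apply', walkStep, h1, h2, ih, ih, intChoose_succ, add_comm]

/-- Vandermonde's convolution. The range may be any `x > r`, because later binomials vanish; this
fits the fixed size of a matrix. -/
theorem intChoose_add (N : ℕ) {r x : ℕ} (h : r < x) (k : ℤ) :
    intChoose (N + r) k = ∑ j ∈ Finset.range x, (r.choose j : ℚ) * intChoose N (k - j) := by
  induction r generalizing x k with
  | zero =>
    rw [Finset.sum_eq_single_of_mem 0 (by simpa using h) fun j _ hj => by
      rw [Nat.choose_eq_zero_of_lt (by omega)]; simp]
    simp
  | succ r ih =>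
    obtain ⟨x, rfl⟩ : ∃ x', x = x' + 1 := ⟨x - 1, by omega⟩
    rw [← add_assoc, intChoose_succ, ih (x := x + 1) (by omega), ih (x := x) (by omega),
      Finset.sum_range_succ', Finset.sum_range_succ' (n := x), add_right_comm,
      ← Finset.sum_add_distrib]
    congr 1
    · refine Finset.sum_congr rfl fun j _ => ?_
      have : k - 1 - (j : ℤ) = k - (j + 1 : ℕ) := by push_cast; ring
      rw [this, Nat.choose_succ_succ]
      push_cast
      ring
    · simp

/-- Terms with `k ≤ a` vanish; after the shift by `a + 1` and multiplication by `p!` and `(2(a + 1 +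
M))!` this is the Chu–Vandermonde sum of `C(p, k) C(2(a + 1 + M), M - k)`. -/
theorem sum_invFact_eq_choose (p a M : ℕ) {m : ℕ} (hm : a + 1 + M < m) :
    ∑ k ∈ Finset.range m, invFact (k - a - 1) * invFact (p + a + 1 - k) *
      (invFact ((a + 1 + M : ℕ) + k) * invFact ((a + 1 + M : ℕ) - k)) =
      ((p + 2 * (a + 1 + M)).choose M : ℚ) / (p.factorial * (2 * (a + 1 + M)).factorial) := by
  rw [Nat.add_choose_eq, Finset.Nat.sum_antidiagonal_eq_sum_range_succ_mk]
  obtain ⟨m, rfl⟩ : ∃ m', m = a + 1 + m' := ⟨m - (a + 1), by omega⟩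
  rw [Finset.sum_range_add, Finset.sum_eq_zero fun k hk => by
    rw [invFact_of_neg (z := (k : ℤ) - a - 1) (by have := Finset.mem_range.1 hk; omega)]; ring,
    zero_add]
  rw [← Finset.sum_subset (s₁ := Finset.range (M + 1)) (by
    intro k hk; simp only [Finset.mem_range] at *; omega)]
  · rw [Nat.cast_sum, Finset.sum_div]
    refine Finset.sum_congr rfl fun k hk => ?_
    have hk : k ≤ M := by simpa [Nat.lt_succ_iff] using hk
    obtain ⟨u, rfl⟩ := Nat.exists_eq_add_of_le hk
    have e1 : ((a + 1 + k : ℕ) : ℤ) - a - 1 = (k : ℕ) := by push_cast; ring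
    have e2 : (p : ℤ) + a + 1 - (a + 1 + k : ℕ) = p - k := by push_cast; ring
    have e3 : ((a + 1 + (k + u) : ℕ) : ℤ) + (a + 1 + k : ℕ) = (2 * (a + 1 + (k + u)) - u : ℕ) := by
      omega
    have e4 : ((a + 1 + (k + u) : ℕ) : ℤ) - (a + 1 + k : ℕ) = (u : ℕ) := by push_cast; ring
    rw [e1, e2, e3, e4]
    simp only [invFact_natCast, add_tsub_cancel_left]
    push_cast
    rw [Nat.cast_choose ℚ (show u ≤ 2 * (a + 1 + (k + u)) by omega)]
    rcases le_or_gt k p with hkp | hkp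
    · obtain ⟨v, rfl⟩ := Nat.exists_eq_add_of_le hkp
      have e5 : ((k + v : ℕ) : ℤ) - k = (v : ℕ) := by push_cast; ring
      rw [e5, invFact_natCast, Nat.cast_choose ℚ (Nat.le_add_right k v), add_tsub_cancel_left]
      have h1 : ((k + v).factorial : ℚ) ≠ 0 := by positivity
      have h2 : ((2 * (a + 1 + (k + u))).factorial : ℚ) ≠ 0 := by positivity
      field_simp
    · rw [invFact_of_neg (by omega), Nat.choose_eq_zero_of_lt hkp]
      simp
  · intro k _ hk
    rw [Finset.mem_range] at hk
    rw [invFact_of_neg (z := ((a + 1 + M : ℕ) : ℤ) - (a + 1 + k : ℕ)) (by omega)]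
    ring

/-! ### Ballot numbers -/

/-- The number of walks of length `2 (m - 1)` on the positive integers from `2 k` to `2`, as an odd
function of `k`. -/
def ballot (m : ℕ) (k : ℤ) : ℚ :=
  2 * (2 * m - 1).factorial * (k * invFact (m + k) * invFact (m - k))

theorem ballot_succ (m : ℕ) (hm : 1 ≤ m) (k : ℤ) :
    ballot (m + 1) k = ballot m (k - 1) + 2 * ballot m k + ballot m (k + 1) := by
  obtain ⟨m, rfl⟩ : ∃ m', m = m' + 1 := ⟨m - 1, by omega⟩
  have h1 := invFact_sub_one (m + 1 + 1 + k)
  have h2 := invFact_sub_one (m + 1 + 1 - k)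
  have h3 := invFact_sub_one (m + 1 + k)
  have h4 := invFact_sub_one (m + 1 - k)
  have e1 : (m : ℤ) + 1 + 1 + k - 1 = m + 1 + k := by ring
  have e2 : (m : ℤ) + 1 + 1 - k - 1 = m + 1 - k := by ring
  have e3 : (m : ℤ) + 1 + (k - 1) = m + 1 + k - 1 := by ring
  have e4 : (m : ℤ) + 1 - (k - 1) = m + 1 + 1 - k := by ring
  have e5 : (m : ℤ) + 1 + (k + 1) = m + 1 + 1 + k := by ring
  have e6 : (m : ℤ) + 1 - (k + 1) = m + 1 - k - 1 := by ring
  rw [e1] at h1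
  rw [e2] at h2
  simp only [ballot]
  push_cast
  rw [e3, e4, e5, e6, h3, h4, h1, h2, show 2 * (m + 1 + 1) - 1 = 2 * m + 1 + 1 + 1 by omega,
    show 2 * (m + 1) - 1 = 2 * m + 1 by omega, Nat.factorial_succ (2 * m + 1 + 1),
    Nat.factorial_succ (2 * m + 1)]
  push_cast
  ring

theorem ballot_eq_zero {m : ℕ} {k : ℤ} (h : m < k) : ballot m k = 0 := by
  rw [ballot, invFact_of_neg (z := m - k) (by omega)]
  ring

theorem ballot_zero (m : ℕ) : ballot m 0 = 0 := by simp [ballot]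

theorem ballot_self (m : ℕ) : ballot (m + 1) (m + 1) = 1 := by
  have h1 := invFact_natCast (2 * m + 1 + 1)
  have h2 := invFact_natCast 0
  have h3 : ((m + 1 : ℕ) : ℤ) + (m + 1) = (2 * m + 1 + 1 : ℕ) := by push_cast; ring
  have h4 : ((m + 1 : ℕ) : ℤ) - (m + 1) = (0 : ℕ) := by push_cast; ring
  have h5 : ((2 * m + 1).factorial : ℚ) ≠ 0 := by positivity
  rw [ballot, h3, h4, h1, h2, Nat.factorial_succ, show 2 * (m + 1) - 1 = 2 * m + 1 by omega]
  push_cast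
  field_simp
  norm_num
  ring

/-- By oddness only positive positions matter. The induction moves two steps at a time from `f` to
the ballot numbers by summation by parts; `M` only has to leave room for the shifted support. -/
theorem walkStep_iterate_two_mul_apply_two (k : ℕ) {f : ℤ → ℚ} (hf : ∀ X, f (-X) = -f X) {M : ℕ}
    (hM : k + 2 ≤ M) :
    walkStep^[2 * k] f 2 = ∑ i ∈ Finset.range M, ballot (k + 1) i * f (2 * i) := by
  have hf0 : f 0 = 0 := by have := hf 0; rw [neg_zero] at this; linarith
  induction k generalizing f with
  | zero =>
    rw [Finset.sum_eq_single_of_mem 1 (by simp only [Finset.mem_range]; omega)]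
    · have := ballot_self 0
      simp only [zero_add, Nat.cast_zero] at this
      simp [this]
    · intro i _ hi
      rcases Nat.lt_or_gt_of_ne hi with h | h
      · obtain rfl : i = 0 := by omega
        simp [hf0]
      · rw [ballot_eq_zero (by push_cast; omega), zero_mul]
  | succ k ih =>
    have h2 : ∀ X, walkStep^[2] f X = f (X - 2) + 2 * f X + f (X + 2) := fun X => by
      simp only [Function.iterate_succ_apply, Function.iterate_zero, id, walkStep]
      rw [show X - 1 - 1 = X - 2 by ring, show X - 1 + 1 = X by ring, show X + 1 - 1 = X by ring,
        show X + 1 + 1 = X + 2 by ring]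
      ring
    rw [show 2 * (k + 1) = 2 * k + 2 by ring, Function.iterate_add_apply,
      ih (walkStep_iterate_neg hf 2) (by omega) (walkStep_iterate_zero hf 2)]
    simp only [h2, mul_add, Finset.sum_add_distrib, ballot_succ (k + 1) (by omega), add_mul]
    -- The boundary terms of both shifts vanish: at 0 by oddness, at the upper end by the support of
    -- `ballot`.
    have s1 : ∑ i ∈ Finset.range M, ballot (k + 1) i * f (2 * i - 2) =
        ∑ i ∈ Finset.range M, ballot (k + 1) (i + 1) * f (2 * i) := by
      have := Finset.sum_range_succ (fun i : ℕ => ballot (k + 1) i * f (2 * i - 2)) M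
      rw [Finset.sum_range_succ', ballot_eq_zero (k := (M : ℤ)) (by push_cast; omega)] at this
      rw [Nat.cast_zero, ballot_zero, zero_mul, zero_mul, add_zero, add_zero] at this
      rw [← this]
      refine Finset.sum_congr rfl fun i _ => ?_
      push_cast
      rw [show 2 * ((i : ℤ) + 1) - 2 = 2 * i by ring]
    have s2 : ∑ i ∈ Finset.range M, ballot (k + 1) i * f (2 * i + 2) =
        ∑ i ∈ Finset.range M, ballot (k + 1) (i - 1) * f (2 * i) := by
      have := Finset.sum_range_succ (fun i : ℕ => ballot (k + 1) (i - 1) * f (2 * i)) M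
      rw [Finset.sum_range_succ', ballot_eq_zero (k := (M : ℤ) - 1) (by push_cast; omega)] at this
      rw [Nat.cast_zero, mul_zero, hf0, mul_zero, zero_mul, add_zero, add_zero] at this
      rw [← this]
      refine Finset.sum_congr rfl fun i _ => ?_
      push_cast
      rw [show 2 * ((i : ℤ) + 1) = 2 * i + 2 by ring, add_sub_cancel_right]
    rw [s1, s2]
    have s3 : ∀ i : ℕ, ballot (k + 1) i * (2 * f (2 * i)) = 2 * ballot (k + 1) i * f (2 * i) :=
      fun i => by ring
    simp only [s3]
    ring

/-! ### Evaluation of the determinant -/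

/-- Left multiplication by the unitriangular matrix of ballot numbers lets the walks that lead to
row `l` run `2l` steps further and end at 2. All rows then evaluate at the same point, with `2(c +
l)` steps. -/
theorem det_tilingMatrix (a x b c : ℕ) :
    det (tilingMatrix a x b c) = det (of fun l j : Fin (a + x) =>
      ∑ i ∈ Finset.range (c + a + x + 1), ballot (c + l + 1) i * sourceWalk a x b j (2 * i)) := by
  let U : Matrix (Fin (a + x)) (Fin (a + x)) ℚ :=
    of fun l i => ballot ((l : ℕ) + 1) ((i : ℕ) + 1)
  have hU : det U = 1 := by
    rw [det_of_isLowerTriangular U fun i j hij => ballot_eq_zero (by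
      have : i < j := hij
      simp only [Fin.lt_def] at this
      push_cast
      omega)]
    exact Finset.prod_eq_one fun i _ => ballot_self i
  rw [← one_mul (det (tilingMatrix a x b c)), ← hU, ← det_mul]
  congr 1
  ext l j
  rw [mul_apply, of_apply, ← walkStep_iterate_two_mul_apply_two (c + l) (sourceWalk_neg a x b j)
    (by omega), show 2 * (c + (l : ℕ)) = 2 * l + 2 * c by ring, Function.iterate_add_apply,
    walkStep_iterate_two_mul_apply_two l (walkStep_iterate_neg (sourceWalk_neg a x b j) _)
      (M := a + x + 1) (by omega), Finset.sum_range_succ', Nat.cast_zero, ballot_zero, zero_mul,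
    add_zero, ← Fin.sum_univ_eq_sum_range (fun i => ballot ((l : ℕ) + 1) (i + 1 : ℕ) *
      walkStep^[2 * c] (sourceWalk a x b j) (2 * (i + 1 : ℕ)))]
  refine Finset.sum_congr rfl fun i _ => ?_
  simp only [U, tilingMatrix, of_apply]
  push_cast
  rw [mul_add, mul_one, add_comm (2 : ℤ)]

/-! ### Change of polynomial basis and block form -/

open Polynomial in
-- The passage from powers to monic polynomials of degrees 0, 1, … is unitriangular.
theorem det_linearMap_monic {n : ℕ} (Λ : Fin n → (ℚ[X] →ₗ[ℚ] ℚ)) (p : Fin n → ℚ[X])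
    (hdeg : ∀ i, (p i).natDegree = i) (hp : ∀ i, (p i).Monic) :
    det (of fun i j => Λ j (p i)) = det (of fun i j : Fin n => Λ j (X ^ (i : ℕ))) := by
  have h : (of fun i j => Λ j (p i)) =
      (of fun k i : Fin n => (p i).coeff k)ᵀ * (of fun i j : Fin n => Λ j (X ^ (i : ℕ))) := by
    ext i j
    rw [mul_apply]
    simp only [transpose_apply, of_apply]
    conv_lhs => rw [(p i).as_sum_range' n (by rw [hdeg]; exact i.2)]
    rw [map_sum, ← Fin.sum_univ_eq_sum_range (fun k => Λ j (monomial k ((p i).coeff k)))]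
    refine Finset.sum_congr rfl fun k _ => ?_
    rw [← C_mul_X_pow_eq_monomial, ← smul_eq_C_mul, map_smul, smul_eq_mul]
  rw [h, det_mul, det_transpose, det_matrixOfPolynomials p hdeg hp, one_mul]

open Polynomial in
/-- The summation of an even function, given as a polynomial in the square, against `ψ`. -/
def evenFunctional (m : ℕ) (ψ : ℤ → ℚ) : ℚ[X] →ₗ[ℚ] ℚ where
  toFun p := ∑ i ∈ Finset.range (m + 1),
    i * invFact (m + i) * invFact (m - i) * p.eval ((i : ℚ) ^ 2) * ψ (2 * i)
  map_add' p q := by simp [mul_add, add_mul, Finset.sum_add_distrib]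
  map_smul' r p := by
    simp only [eval_smul, smul_eq_mul, RingHom.id_apply, Finset.mul_sum]
    exact Finset.sum_congr rfl fun i _ => by ring

open Polynomial in
theorem evenFunctional_apply (m : ℕ) (ψ : ℤ → ℚ) (p : ℚ[X]) :
    evenFunctional m ψ p = ∑ i ∈ Finset.range (m + 1),
      i * invFact (m + i) * invFact (m - i) * p.eval ((i : ℚ) ^ 2) * ψ (2 * i) := rfl

open Polynomial in
/-- The monic polynomial with the roots `m ^ 2, (m - 1) ^ 2, …, (m - k + 1) ^ 2`. -/
noncomputable def topPoly (m k : ℕ) : ℚ[X] :=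
  ∏ e ∈ Finset.range k, (X - C (((m : ℚ) - e) ^ 2))

open Polynomial in
/-- The monic polynomial with the roots `1, 4, …, a ^ 2`. -/
noncomputable def bottomPoly (a : ℕ) : ℚ[X] :=
  ∏ e ∈ Finset.range a, (X - C (((e : ℚ) + 1) ^ 2))

open Polynomial in
theorem monic_topPoly (m k : ℕ) : (topPoly m k).Monic := monic_prod_X_sub_C _ _

open Polynomial in
theorem monic_bottomPoly (a : ℕ) : (bottomPoly a).Monic := monic_prod_X_sub_C _ _

open Polynomial in
theorem natDegree_topPoly (m k : ℕ) : (topPoly m k).natDegree = k := by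
  rw [topPoly, natDegree_finsetProd_X_sub_C_eq_card, Finset.card_range]

open Polynomial in
theorem natDegree_bottomPoly (a : ℕ) : (bottomPoly a).natDegree = a := by
  rw [bottomPoly, natDegree_finsetProd_X_sub_C_eq_card, Finset.card_range]

/-- The factor `i² - (m - e)² = -(m - e + i)(m - e - i)` lowers both factorials by one and
contributes a sign. -/
theorem eval_topPoly (m k : ℕ) (i : ℤ) :
    invFact (m + i) * invFact (m - i) * (topPoly m k).eval ((i : ℚ) ^ 2) =
      (-1) ^ k * (invFact (m - k + i) * invFact (m - k - i)) := by
  induction k with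
  | zero => simp [topPoly]
  | succ k ih =>
    have h1 := invFact_sub_one (m - k + i)
    have h2 := invFact_sub_one (m - k - i)
    rw [show (m : ℤ) - k + i - 1 = m - (k + 1 : ℕ) + i by push_cast; ring] at h1
    rw [show (m : ℤ) - k - i - 1 = m - (k + 1 : ℕ) - i by push_cast; ring] at h2
    rw [topPoly, Finset.prod_range_succ, Polynomial.eval_mul, ← mul_assoc, ← topPoly, ih, h1, h2]
    simp only [Polynomial.eval_sub, Polynomial.eval_X, Polynomial.eval_C]
    push_cast
    ring

/-- `i` times the product of `i² - e²` for `e = 1, …, a` is the product of the integers from `i - a`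
to `i + a`. -/
theorem eval_bottomPoly (a : ℕ) (i : ℤ) :
    (i : ℚ) * (bottomPoly a).eval ((i : ℚ) ^ 2) * invFact (a + i) = invFact (i - a - 1) := by
  induction a with
  | zero =>
    have := invFact_sub_one i
    simp [bottomPoly, this]
  | succ a ih =>
    have h1 := invFact_sub_one (a + 1 + i)
    have h2 := invFact_sub_one (i - a - 1)
    rw [show (a : ℤ) + 1 + i - 1 = a + i by ring] at h1
    rw [h1] at ih
    rw [show i - ((a + 1 : ℕ) : ℤ) - 1 = i - a - 1 - 1 by push_cast; ring, h2, ← ih, bottomPoly,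
      Finset.prod_range_succ, Polynomial.eval_mul, ← bottomPoly]
    simp only [Polynomial.eval_sub, Polynomial.eval_X, Polynomial.eval_C]
    push_cast
    ring

theorem eval_bottomPoly_eq_zero {a i : ℕ} (h : i ≤ a) :
    (i : ℚ) * (bottomPoly a).eval ((i : ℚ) ^ 2) = 0 := by
  rcases i with _ | i
  · simp
  · rw [bottomPoly, Polynomial.eval_prod, Finset.prod_eq_zero (i := i)]
    · simp
    · simpa using h
    · simp

/-- All ballot weights are brought over the common factor with `m = c + a + x`; row `l` lacks `a + x
- 1 - l` factors, whence the reversed index. Absolute values dispose of the signs and of the row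
reversal. -/
theorem abs_det_tilingMatrix (a x b c : ℕ) :
    |det (tilingMatrix a x b c)| = (∏ l ∈ Finset.range (a + x), 2 * ((2 * (c + l) + 1).factorial : ℚ)) *
      |det (of fun l j : Fin (a + x) =>
        evenFunctional (c + a + x) (sourceWalk a x b j) (topPoly (c + a + x) l))| := by
  have h1 : (of fun l j : Fin (a + x) => ∑ i ∈ Finset.range (c + a + x + 1),
      ballot (c + l + 1) i * sourceWalk a x b j (2 * i)) = of fun l j : Fin (a + x) =>
      (2 * ((2 * (c + (l : ℕ)) + 1).factorial : ℚ) * (-1) ^ (Fin.rev l : ℕ)) *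
        (of fun l j : Fin (a + x) => evenFunctional (c + a + x) (sourceWalk a x b j)
          (topPoly (c + a + x) (Fin.rev l))) l j := by
    ext l j
    rw [of_apply, of_apply, of_apply, evenFunctional_apply, Finset.mul_sum]
    refine Finset.sum_congr rfl fun i _ => ?_
    have h2 := eval_topPoly (c + a + x) (Fin.rev l) i
    have h3 : ((c + a + x : ℕ) : ℤ) - (Fin.rev l : ℕ) = (c + l + 1 : ℕ) := by
      rw [Fin.val_rev]
      omega
    rw [h3] at h2
    rw [ballot, show 2 * (c + (l : ℕ) + 1) - 1 = 2 * (c + l) + 1 by omega]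
    have h4 : ((-1 : ℚ) ^ (Fin.rev l : ℕ)) * (-1) ^ (Fin.rev l : ℕ) = 1 := by
      rw [← mul_pow]; simp
    have h5 : invFact ((c + l + 1 : ℕ) + i) * invFact ((c + l + 1 : ℕ) - i) =
        (-1) ^ (Fin.rev l : ℕ) * (invFact ((c + a + x : ℕ) + i) * invFact ((c + a + x : ℕ) - i) *
        (topPoly (c + a + x) (Fin.rev l)).eval (((i : ℤ) : ℚ) ^ 2)) := by
      rw [h2, ← mul_assoc, h4, one_mul]
    rw [mul_assoc (((i : ℤ) : ℚ)), h5]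
    push_cast
    ring
  rw [det_tilingMatrix, h1, det_mul_column, abs_mul]
  congr 1
  · rw [Finset.abs_prod, ← Fin.prod_univ_eq_prod_range
      (fun l => 2 * ((2 * (c + l) + 1).factorial : ℚ))]
    refine Finset.prod_congr rfl fun l _ => ?_
    rw [abs_mul, abs_pow, abs_neg, abs_one, one_pow, mul_one, abs_of_nonneg (by positivity)]
  · exact abs_det_submatrix_equiv_equiv Fin.revPerm (Equiv.refl _) (of fun l j : Fin (a + x) =>
      evenFunctional (c + a + x) (sourceWalk a x b j) (topPoly (c + a + x) l))

open Polynomial in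
-- The last `x` basis polynomials are multiples of `bottomPoly a`, which vanishes at the squares 1,
-- …, a² where the short sources sit; this is the zero block.
theorem det_evenFunctional_eq_mul (a x b m : ℕ) :
    det (of fun l j : Fin (a + x) => evenFunctional m (sourceWalk a x b j) (topPoly m l)) =
      det (of fun l j : Fin a => evenFunctional m (sourceWalk a x b (Fin.castAdd x j)) (X ^ (l : ℕ))) *
      det (of fun l j : Fin x => evenFunctional m (sourceWalk a x b (Fin.natAdd a j))
        (bottomPoly a * topPoly m l)) := by
  let q : Fin (a + x) → ℚ[X] :=
    Fin.addCases (fun l => X ^ (l : ℕ)) (fun l => bottomPoly a * topPoly m l)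
  have hq1 : ∀ i, (q i).natDegree = i := by
    refine Fin.addCases (fun i => ?_) fun i => ?_
    · simp [q]
    · simp only [q, Fin.addCases_right, Fin.val_natAdd]
      rw [(monic_bottomPoly a).natDegree_mul (monic_topPoly _ _), natDegree_bottomPoly,
        natDegree_topPoly]
  have hq2 : ∀ i, (q i).Monic := by
    refine Fin.addCases (fun i => ?_) fun i => ?_
    · simp [q]
    · simpa [q] using (monic_bottomPoly a).mul (monic_topPoly _ _)
  rw [det_linearMap_monic (fun j => evenFunctional m (sourceWalk a x b j)) (fun l => topPoly m l)
    (fun l => natDegree_topPoly _ _) (fun l => monic_topPoly _ _),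
    ← det_linearMap_monic (fun j => evenFunctional m (sourceWalk a x b j)) q hq1 hq2,
    ← det_submatrix_equiv_self finSumFinEquiv]
  have : (of fun l j => evenFunctional m (sourceWalk a x b j) (q l)).submatrix finSumFinEquiv
      finSumFinEquiv = fromBlocks
      (of fun l j : Fin a => evenFunctional m (sourceWalk a x b (Fin.castAdd x j)) (X ^ (l : ℕ)))
      (of fun l j => evenFunctional m (sourceWalk a x b (Fin.natAdd a j)) (X ^ (l : ℕ))) 0
      (of fun l j : Fin x => evenFunctional m (sourceWalk a x b (Fin.natAdd a j))
        (bottomPoly a * topPoly m l)) := by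
    ext (i | i) (j | j)
    · simp [q]
    · simp [q]
    · simp only [submatrix_apply, finSumFinEquiv_apply_left, finSumFinEquiv_apply_right, of_apply,
        fromBlocks_apply₂₁, Matrix.zero_apply, q, Fin.addCases_right, evenFunctional_apply]
      refine Finset.sum_eq_zero fun k _ => ?_
      rcases le_or_gt k a with hk | hk
      · have := eval_bottomPoly_eq_zero hk
        rw [eval_mul]
        linear_combination (invFact (m + k) * invFact (m - k) * eval ((k : ℚ) ^ 2) (topPoly m i) *
          sourceWalk a x b (Fin.castAdd x j) (2 * k)) * this
      · have := j.2
        rw [sourceWalk_castAdd _ _ _ _ (by omega), if_neg (by omega), mul_zero]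
    · simp [q]
  rw [this, det_fromBlocks_zero₂₁]

open Polynomial in
theorem det_evenFunctional_castAdd (a x b m : ℕ) (hm : a ≤ m) :
    det (of fun l j : Fin a => evenFunctional m (sourceWalk a x b (Fin.castAdd x j)) (X ^ (l : ℕ))) =
      (∏ t ∈ Finset.range a, ((t : ℚ) + 1) / ((m + t + 1).factorial * (m - t - 1).factorial)) *
        det (of fun l j : Fin a => (((j : ℕ) + 1 : ℚ) ^ 2) ^ (l : ℕ)) := by
  rw [← Fin.prod_univ_eq_prod_range
    (fun t => ((t : ℚ) + 1) / ((m + t + 1).factorial * (m - t - 1).factorial)), ← det_mul_row]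
  congr 1
  ext l j
  rw [of_apply, of_apply, of_apply, evenFunctional_apply,
    Finset.sum_eq_single_of_mem ((j : ℕ) + 1) (by have := j.2; simp only [Finset.mem_range]; omega)]
  · have h1 : (m : ℤ) + ((j : ℕ) + 1 : ℕ) = (m + j + 1 : ℕ) := by push_cast; ring
    have h2 : (m : ℤ) - ((j : ℕ) + 1 : ℕ) = (m - j - 1 : ℕ) := by have := j.2; omega
    rw [sourceWalk_castAdd _ _ _ _ (by push_cast; omega), if_pos (by push_cast; ring), h1, h2,
      invFact_natCast, invFact_natCast, eval_pow, eval_X]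
    push_cast
    field_simp
  · intro k _ hk
    rcases k with _ | k
    · simp
    · rw [sourceWalk_castAdd _ _ _ _ (by push_cast; omega), if_neg (by push_cast; omega), mul_zero]

/-! ### The block of the southern walks -/

open Polynomial in
-- The matrix is a Vandermonde matrix times a coefficient matrix, and Vandermonde determinants are
-- translation invariant.
theorem det_eval_add {n : ℕ} (p : Fin n → ℚ[X]) (hp : ∀ i, (p i).natDegree < n) (v : Fin n → ℚ)
    (s : ℚ) :
    det (of fun i j => (p j).eval (v i + s)) = det (of fun i j => (p j).eval (v i)) := by
  have h : ∀ w : Fin n → ℚ, of (fun i j => (p j).eval (w i)) =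
      vandermonde w * of fun i j : Fin n => (p j).coeff i := fun w => by
    ext i j
    rw [mul_apply, of_apply, eval_eq_sum_range' (hp j),
      ← Fin.sum_univ_eq_sum_range (fun k => (p j).coeff k * w i ^ k)]
    exact Finset.sum_congr rfl fun k _ => mul_comm _ _
  rw [h, h, det_mul, det_mul, det_vandermonde_add]

theorem prod_range_add_natCast (n k : ℕ) :
    ((n + k).factorial : ℚ) = n.factorial * ∏ i ∈ Finset.range k, ((n : ℚ) + 1 + i) := by
  induction k with
  | zero => simp
  | succ k ih =>
    rw [Finset.prod_range_succ, ← mul_assoc, ← ih, ← add_assoc, Nat.factorial_succ]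
    push_cast
    ring

open Polynomial in
-- With `(A + 2k)! / (B + k + x - 1)!` taken out of row `k`, the entries are polynomials in `k` of
-- degree below `x`. Translating the nodes to `-B, -(B + 1), …` makes the matrix triangular, and the
-- diagonal can be read off.
theorem abs_det_factorial_quotient (A B x : ℕ) (hAB : A ≤ 2 * B) :
    |det (of fun k r : Fin x => ((A + 2 * k + r).factorial : ℚ) / (B + k + r).factorial)| =
      ∏ r ∈ Finset.range x, ((A + 2 * r).factorial : ℚ) / (B + r + (x - 1)).factorial *
        r.factorial * ∏ i ∈ Finset.range r, ((2 * B - A + 2 * r : ℚ) - 1 - i) := by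
  let p : Fin x → ℚ[X] := fun r => (∏ i ∈ Finset.range r, (C 2 * X + C ((A : ℚ) + 1 + i))) *
    ∏ i ∈ Finset.range (x - 1 - r), (X + C ((B : ℚ) + r + 1 + i))
  have hp : ∀ r, (p r).natDegree < x := fun r => by
    have h1 : (∏ i ∈ Finset.range r, (C 2 * X + C ((A : ℚ) + 1 + i))).natDegree ≤ (r : ℕ) := by
      refine (natDegree_prod_le _ _).trans ((Finset.sum_le_card_nsmul _ _ 1 fun i _ => ?_).trans ?_)
      · exact natDegree_linear_le
      · simp
    have h2 : (∏ i ∈ Finset.range (x - 1 - r), (X + C ((B : ℚ) + r + 1 + i))).natDegree ≤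
        x - 1 - r := by
      refine (natDegree_prod_le _ _).trans ((Finset.sum_le_card_nsmul _ _ 1 fun i _ => ?_).trans ?_)
      · exact (natDegree_X_add_C _).le
      · simp
    have h3 : (p r).natDegree ≤ _ := natDegree_mul_le
    have := r.2
    omega
  have hpe : ∀ r (z : ℚ), (p r).eval z = (∏ i ∈ Finset.range r, (2 * z + ((A : ℚ) + 1 + i))) *
      ∏ i ∈ Finset.range (x - 1 - r), (z + ((B : ℚ) + r + 1 + i)) := fun r z => by
    simp only [p, eval_mul, eval_prod, eval_add, eval_C, eval_X]
  have h1 : (of fun k r : Fin x => ((A + 2 * k + r).factorial : ℚ) / (B + k + r).factorial) =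
      of fun k r : Fin x => (((A + 2 * (k : ℕ)).factorial : ℚ) / (B + k + (x - 1)).factorial) *
        (of fun k r : Fin x => (p r).eval ((k : ℕ) : ℚ)) k r := by
    ext k r
    have e1 := prod_range_add_natCast (A + 2 * k) r
    have e2 := prod_range_add_natCast (B + k + r) (x - 1 - r)
    have e3 : B + (k : ℕ) + r + (x - 1 - r) = B + k + (x - 1) := by have := r.2; omega
    rw [e3] at e2
    rw [of_apply, of_apply, of_apply, hpe, e1, e2]
    have e4 : ∏ i ∈ Finset.range (x - 1 - r), (((B + k + r : ℕ) : ℚ) + 1 + i) =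
        ∏ i ∈ Finset.range (x - 1 - r), (((k : ℕ) : ℚ) + ((B : ℚ) + r + 1 + i)) :=
      Finset.prod_congr rfl fun i _ => by push_cast; ring
    have e5 : ∏ i ∈ Finset.range r, (((A + 2 * k : ℕ) : ℚ) + 1 + i) =
        ∏ i ∈ Finset.range r, (2 * ((k : ℕ) : ℚ) + ((A : ℚ) + 1 + i)) :=
      Finset.prod_congr rfl fun i _ => by push_cast; ring
    have e6 : ∏ i ∈ Finset.range (x - 1 - r), (((k : ℕ) : ℚ) + ((B : ℚ) + r + 1 + i)) ≠ 0 :=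
      Finset.prod_ne_zero_iff.2 fun i _ => by positivity
    rw [e4, e5]
    field_simp
  have h2 : (of fun k r : Fin x => (p r).eval (((k : ℕ) : ℚ) + -((B : ℚ) + x - 1))) =
      (of fun s r : Fin x => (p r).eval (-((B : ℚ) + (s : ℕ)))).submatrix Fin.revPerm
        (Equiv.refl _) := by
    ext k r
    simp only [submatrix_apply, of_apply, Fin.revPerm_apply, Fin.val_rev, Equiv.refl_apply]
    congr 1
    have := k.2
    push_cast [Nat.cast_sub (show (k : ℕ) + 1 ≤ x by omega)]
    ring
  have h3 : (of fun s r : Fin x => (p r).eval (-((B : ℚ) + (s : ℕ)))).IsUpperTriangular := by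
    intro s r hsr
    have hsr : r < s := hsr
    rw [Fin.lt_def] at hsr
    have := s.2
    rw [of_apply, hpe, Finset.prod_eq_zero (s := Finset.range (x - 1 - r))
      (i := (s : ℕ) - r - 1), mul_zero]
    · simp only [Finset.mem_range]; omega
    · rw [Nat.cast_sub (by omega), Nat.cast_sub (by omega)]
      push_cast
      ring
  rw [h1, det_mul_column, abs_mul, ← det_eval_add p hp _ (-((B : ℚ) + x - 1)), h2,
    abs_det_submatrix_equiv_equiv, det_of_isUpperTriangular h3, Finset.prod_mul_distrib,
    Finset.prod_mul_distrib, mul_assoc]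
  congr 1
  · rw [← Fin.prod_univ_eq_prod_range
      (fun k => ((A + 2 * k).factorial : ℚ) / (B + k + (x - 1)).factorial), abs_of_nonneg]
    exact Finset.prod_nonneg fun k _ => by positivity
  · rw [← Finset.prod_range_reflect (fun r => (r.factorial : ℚ)), ← Finset.prod_mul_distrib,
      ← Fin.prod_univ_eq_prod_range (fun r => ((x - 1 - r).factorial : ℚ) *
        ∏ i ∈ Finset.range r, ((2 * B - A + 2 * r : ℚ) - 1 - i)), Finset.abs_prod]
    refine Finset.prod_congr rfl fun r _ => ?_
    have e1 := prod_range_add_natCast 0 (x - 1 - r)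
    rw [zero_add, Nat.factorial_zero] at e1
    rw [of_apply, hpe, abs_mul, mul_comm, e1]
    congr 1
    · rw [Nat.cast_one, one_mul, abs_of_nonneg]
      · exact Finset.prod_congr rfl fun i _ => by push_cast; ring
      · refine Finset.prod_nonneg fun i _ => ?_
        rw [show -((B : ℚ) + (r : ℕ)) + ((B : ℚ) + r + 1 + i) = 1 + i by ring]
        positivity
    · rw [Finset.abs_prod]
      refine Finset.prod_congr rfl fun i hi => ?_
      have hi : i + 1 ≤ (r : ℕ) := Finset.mem_range.1 hi
      have hi' : (i : ℚ) + 1 ≤ (r : ℕ) := by exact_mod_cast hi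
      have hAB' : (A : ℚ) ≤ 2 * B := by exact_mod_cast hAB
      rw [abs_of_nonpos (by linarith)]
      ring

/-- Binomial column operations merge the `x` sources into one: column `r` becomes a walk with `2a +
b + 1 + r` steps. Its factorial `(a + i)!` cancels against `bottomPoly`, and the sum over `i` is
`sum_invFact_eq_choose`. -/
theorem abs_det_evenFunctional_natAdd (a x b c : ℕ) :
    |det (of fun l j : Fin x => evenFunctional (c + a + x) (sourceWalk a x b (Fin.natAdd a j))
        (bottomPoly a * topPoly (c + a + x) l))| =
      |det (of fun k r : Fin x => ((2 * a + b + 1 + r).factorial : ℚ) *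
        (((b + r + 2 * (a + 1 + (c + k))).choose (c + k) : ℚ) /
          ((b + r).factorial * (2 * (a + 1 + (c + k))).factorial)))| := by
  set G : Matrix (Fin x) (Fin x) ℚ := of fun k r : Fin x => ((2 * a + b + 1 + r).factorial : ℚ) *
        (((b + r + 2 * (a + 1 + (c + k))).choose (c + k) : ℚ) /
          ((b + r).factorial * (2 * (a + 1 + (c + k))).factorial)) with hG
  let V : Matrix (Fin x) (Fin x) ℚ := of fun j r => ((r : ℕ).choose j : ℚ)
  have hV : det V = 1 := by
    rw [det_of_isUpperTriangular (M := V) fun j r hij => by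
      have hij : r < j := hij
      simp only [V, of_apply]
      rw [Nat.choose_eq_zero_of_lt hij, Nat.cast_zero]]
    exact Finset.prod_eq_one fun i _ => by simp [V]
  rw [← mul_one (det _), ← hV, ← det_mul]
  have h1 : (of fun l j : Fin x => evenFunctional (c + a + x) (sourceWalk a x b (Fin.natAdd a j))
        (bottomPoly a * topPoly (c + a + x) l)) * V =
      of fun l r : Fin x => (-1) ^ (l : ℕ) * (G.submatrix Fin.revPerm (Equiv.refl _)) l r := by
    ext l r
    rw [mul_apply]
    simp only [of_apply, evenFunctional_apply, V, submatrix_apply, Equiv.refl_apply, hG,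
      Fin.revPerm_apply, Finset.sum_mul]
    rw [Finset.sum_comm]
    have h2 := sum_invFact_eq_choose (b + r) a (c + (Fin.rev l : ℕ)) (m := c + a + x + 1)
      (by have := (Fin.rev l).2; omega)
    rw [← h2, Finset.mul_sum, Finset.mul_sum]
    refine Finset.sum_congr rfl fun i _ => ?_
    have h3 := eval_topPoly (c + a + x) l i
    have h4 : ((c + a + x : ℕ) : ℤ) - (l : ℕ) = (a + 1 + (c + (Fin.rev l : ℕ)) : ℕ) := by
      rw [Fin.val_rev]
      omega
    rw [h4] at h3
    -- For `i ≤ a` the source function contains its mirror term, but the factor `bottomPoly` removes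
    -- these positions.
    rcases le_or_gt i a with hi | hi
    · have h5 := eval_bottomPoly_eq_zero hi
      rw [invFact_of_neg (z := (i : ℤ) - a - 1) (by omega)]
      rw [Finset.sum_eq_zero]
      · ring
      · intro j _
        rw [Polynomial.eval_mul]
        linear_combination (invFact ((c + a + x : ℕ) + i) * invFact ((c + a + x : ℕ) - i) *
          (topPoly (c + a + x) l).eval ((i : ℚ) ^ 2) *
          sourceWalk a x b (Fin.natAdd a j) (2 * i) * ((r : ℕ).choose j : ℚ)) * h5
    · have h5 := eval_bottomPoly a i
      have h6 : ∀ j : Fin x, sourceWalk a x b (Fin.natAdd a j) (2 * i) =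
          intChoose (2 * a + b + 1) (a + i - (j : ℕ)) := fun j => by
        have h9 : 2 * (i : ℤ) = b + 1 + 2 * (j : ℕ) - (2 * a + b + 1 : ℕ) +
            2 * (a + i - (j : ℕ)) := by push_cast; ring
        rw [sourceWalk_natAdd _ _ _ _ (by omega), h9, walkStep_iterate_walkStart]
      have h7 := intChoose_add (2 * a + b + 1) r.2 (a + i)
      rw [← Fin.sum_univ_eq_sum_range
        (fun j => ((r : ℕ).choose j : ℚ) * intChoose (2 * a + b + 1) (a + i - j))] at h7
      have h8 : ((2 * a + b + 1 + r : ℕ) : ℤ) - (a + i) = (b + r : ℕ) + a + 1 - i := by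
        push_cast; ring
      rw [intChoose, h8] at h7
      simp only [h6]
      rw [Int.cast_natCast] at h3 h5
      calc _ = (i * (bottomPoly a).eval ((i : ℚ) ^ 2)) * (invFact ((c + a + x : ℕ) + i) *
            invFact ((c + a + x : ℕ) - i) * (topPoly (c + a + x) l).eval ((i : ℚ) ^ 2)) *
            ∑ j : Fin x, ((r : ℕ).choose j : ℚ) * intChoose (2 * a + b + 1) (a + i - (j : ℕ)) := by
              rw [Finset.mul_sum]
              refine Finset.sum_congr rfl fun j _ => ?_
              rw [Polynomial.eval_mul]
              ring
        _ = _ := by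
              rw [h3, ← h7, ← h5]
              ring
  rw [h1, det_mul_column, abs_mul, abs_det_submatrix_equiv_equiv, Finset.abs_prod]
  simp

/-! ### The product formula as a recursion in the width -/

/-- Shifting a run of consecutive factorials trades the first for the next one; this telescopes the
quotients in `tilingProduct_succ`. -/
theorem prod_range_factorial_succ (n k : ℕ) :
    (∏ t ∈ Finset.range k, ((n + t + 1).factorial : ℚ)) * n.factorial =
      (∏ t ∈ Finset.range k, ((n + t).factorial : ℚ)) * (n + k).factorial := by
  induction k with
  | zero => simp
  | succ k ih =>
    rw [Finset.prod_range_succ, Finset.prod_range_succ, mul_right_comm, ih, ← add_assoc]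

/-- The product formula for the number of tilings of `regionB x a b c`, up to a factor that depends
on `a` only. -/
def tilingProduct (x a b c : ℕ) : ℚ :=
  (∏ l ∈ Finset.range (a + x), 2 * ((2 * (c + l) + 1).factorial : ℚ)) *
    (∏ t ∈ Finset.range a,
      ((t : ℚ) + 1) / ((c + a + x + t + 1).factorial * (c + x + t).factorial)) *
    ∏ r ∈ Finset.range x, ((b + 2 * a + 1 + 2 * r).factorial * (b + 2 * c + 2 * a + 2 + 2 * r).factorial *
      r.factorial / ((b + r).factorial * (2 * (a + 1 + (c + r))).factorial * (c + r).factorial *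
        (b + c + 2 * a + 1 + x + r).factorial) : ℚ)

theorem tilingNumber_regionB_eq_tilingProduct (x a b c : ℕ) :
    (tilingNumber (regionB x a b c) : ℚ) =
      |det (of fun l j : Fin a => (((j : ℕ) + 1 : ℚ) ^ 2) ^ (l : ℕ))| * tilingProduct x a b c := by
  have h0 : (tilingNumber (regionB x a b c) : ℚ) = |det (tilingMatrix a x b c)| := by
    rw [← tilingNumber_regionB, abs_of_nonneg (Nat.cast_nonneg _)]
  rw [h0, abs_det_tilingMatrix, det_evenFunctional_eq_mul, det_evenFunctional_castAdd _ _ _ _ (by omega),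
    abs_mul, abs_mul, abs_det_evenFunctional_natAdd]
  have h1 : |∏ t ∈ Finset.range a,
      ((t : ℚ) + 1) / ((c + a + x + t + 1).factorial * (c + a + x - t - 1).factorial)| =
      ∏ t ∈ Finset.range a,
        ((t : ℚ) + 1) / ((c + a + x + t + 1).factorial * (c + x + t).factorial) := by
    rw [abs_of_nonneg (Finset.prod_nonneg fun t _ => by positivity)]
    simp only [div_eq_mul_inv, mul_inv, Finset.prod_mul_distrib]
    congr 2
    rw [← Finset.prod_range_reflect]
    refine Finset.prod_congr rfl fun t ht => ?_
    rw [Finset.mem_range] at ht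
    rw [show c + a + x - (a - 1 - t) - 1 = c + x + t by omega]
  have h2 : (of fun k r : Fin x => ((2 * a + b + 1 + r).factorial : ℚ) *
        (((b + r + 2 * (a + 1 + (c + k))).choose (c + k) : ℚ) /
          ((b + r).factorial * (2 * (a + 1 + (c + k))).factorial))) =
      of fun k r : Fin x => (((2 * a + b + 1 + (r : ℕ)).factorial : ℚ) / (b + r).factorial) *
        (of fun k r : Fin x => (1 / (((2 * (a + 1 + (c + (k : ℕ)))).factorial : ℚ) * (c + k).factorial)) *
          (of fun k r : Fin x => ((b + 2 * c + 2 * a + 2 + 2 * k + r).factorial : ℚ) /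
            (b + c + 2 * a + 2 + k + r).factorial) k r) k r := by
    ext k r
    simp only [of_apply]
    rw [Nat.cast_choose ℚ (by omega),
      show b + (r : ℕ) + 2 * (a + 1 + (c + k)) - (c + k) = b + c + 2 * a + 2 + k + r by omega,
      show b + (r : ℕ) + 2 * (a + 1 + (c + k)) = b + 2 * c + 2 * a + 2 + 2 * k + r by omega]
    field_simp
  rw [h1, h2, det_mul_row, det_mul_column, abs_mul, abs_mul,
    abs_det_factorial_quotient _ _ _ (by omega), Finset.abs_prod, Finset.abs_prod, tilingProduct,
    Fin.prod_univ_eq_prod_range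
      (fun r => |((2 * a + b + 1 + r).factorial : ℚ) / (b + r).factorial|),
    Fin.prod_univ_eq_prod_range
      (fun k => |1 / (((2 * (a + 1 + (c + k))).factorial : ℚ) * (c + k).factorial)|),
    ← Finset.prod_mul_distrib, ← Finset.prod_mul_distrib]
  have h3 : ∀ r ∈ Finset.range x, |((2 * a + b + 1 + r).factorial : ℚ) / (b + r).factorial| *
      (|1 / (((2 * (a + 1 + (c + r))).factorial : ℚ) * (c + r).factorial)| *
      (((b + 2 * c + 2 * a + 2 + 2 * r).factorial : ℚ) /
        (b + c + 2 * a + 2 + r + (x - 1)).factorial * r.factorial *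
        ∏ i ∈ Finset.range r, ((2 * (b + c + 2 * a + 2 : ℕ) - (b + 2 * c + 2 * a + 2 : ℕ) + 2 * r : ℚ)
          - 1 - i))) =
      ((b + 2 * a + 1 + 2 * r).factorial * (b + 2 * c + 2 * a + 2 + 2 * r).factorial *
      r.factorial / ((b + r).factorial * (2 * (a + 1 + (c + r))).factorial * (c + r).factorial *
        (b + c + 2 * a + 1 + x + r).factorial) : ℚ) := by
    intro r hr
    rw [Finset.mem_range] at hr
    have e1 := prod_range_add_natCast (b + 2 * a + 1 + r) r
    rw [← Finset.prod_range_reflect] at e1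
    have e2 : ∏ i ∈ Finset.range r, (((b + 2 * a + 1 + r : ℕ) : ℚ) + 1 + (r - 1 - i : ℕ)) =
        ∏ i ∈ Finset.range r, ((2 * (b + c + 2 * a + 2 : ℕ) - (b + 2 * c + 2 * a + 2 : ℕ) + 2 * r : ℚ)
          - 1 - i) := by
      refine Finset.prod_congr rfl fun i hi => ?_
      rw [Finset.mem_range] at hi
      rw [show r - 1 - i = r - (i + 1) by omega, Nat.cast_sub (by omega)]
      push_cast
      ring
    rw [e2] at e1
    rw [abs_of_nonneg (by positivity), abs_of_nonneg (by positivity),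
      show b + 2 * a + 1 + 2 * r = b + 2 * a + 1 + r + r by ring, e1,
      show b + c + 2 * a + 2 + r + (x - 1) = b + c + 2 * a + 1 + x + r by omega,
      show 2 * a + b + 1 + r = b + 2 * a + 1 + r by ring]
    field_simp
  rw [Finset.prod_congr rfl h3]
  ring

/-- The quotient of the tiling numbers of `regionB (x + 1) a b c` and `regionB x a b c`. -/
def tilingRatio (x a b c : ℕ) : ℚ :=
  ((b + 2 * a + 1 + 2 * x).factorial * (b + 2 * c + 2 * a + 2 + 2 * x).factorial *
    x.factorial * (b + c + 2 * a + 1 + x).factorial) /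
  ((c + 2 * a + 1 + x).factorial * (b + x).factorial * (b + c + 2 * a + 1 + 2 * x).factorial *
    (b + c + 2 * a + 2 + 2 * x).factorial)

theorem tilingProduct_succ (x a b c : ℕ) :
    tilingProduct (x + 1) a b c = tilingProduct x a b c * tilingRatio x a b c := by
  have h1 := prod_range_factorial_succ (c + a + x + 1) a
  have h2 := prod_range_factorial_succ (c + x) a
  have h3 := prod_range_factorial_succ (b + c + 2 * a + 1 + x) x
  have p1 : ∏ t ∈ Finset.range a, ((c + a + x + 1 + t + 1).factorial : ℚ) =
      ∏ t ∈ Finset.range a, ((c + a + (x + 1) + t + 1).factorial : ℚ) :=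
    Finset.prod_congr rfl fun t _ => by
      rw [show c + a + (x + 1) + t + 1 = c + a + x + 1 + t + 1 by ring]
  have p2 : ∏ t ∈ Finset.range a, ((c + a + x + 1 + t).factorial : ℚ) =
      ∏ t ∈ Finset.range a, ((c + a + x + t + 1).factorial : ℚ) :=
    Finset.prod_congr rfl fun t _ => by
      rw [show c + a + x + 1 + t = c + a + x + t + 1 by ring]
  have p3 : ∏ t ∈ Finset.range a, ((c + x + t + 1).factorial : ℚ) =
      ∏ t ∈ Finset.range a, ((c + (x + 1) + t).factorial : ℚ) :=
    Finset.prod_congr rfl fun t _ => by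
      rw [show c + (x + 1) + t = c + x + t + 1 by ring]
  have p4 : ∏ t ∈ Finset.range x, ((b + c + 2 * a + 1 + x + t + 1).factorial : ℚ) =
      ∏ t ∈ Finset.range x, ((b + c + 2 * a + 1 + (x + 1) + t).factorial : ℚ) :=
    Finset.prod_congr rfl fun t _ => by
      rw [show b + c + 2 * a + 1 + (x + 1) + t = b + c + 2 * a + 1 + x + t + 1 by ring]
  rw [p1, p2] at h1
  rw [p3] at h2
  rw [p4] at h3
  rw [tilingProduct, tilingProduct, tilingRatio, ← add_assoc, Finset.prod_range_succ]
  simp only [Finset.prod_div_distrib, Finset.prod_mul_distrib]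
  rw [Finset.prod_range_succ (fun t => ((b + c + 2 * a + 1 + (x + 1) + t).factorial : ℚ))]
  rw [← eq_div_iff (by positivity)] at h1 h2 h3
  rw [h1, h2, h3]
  simp only [Finset.prod_range_succ _ x]
  have e1 : ((2 * (a + 1 + (c + x))).factorial : ℚ) =
      2 * (c + a + x + 1) * (2 * (c + (a + x)) + 1).factorial := by
    rw [show 2 * (a + 1 + (c + x)) = 2 * (c + (a + x)) + 1 + 1 by ring, Nat.factorial_succ]
    push_cast
    ring
  have e2 : ((c + a + x + 1).factorial : ℚ) = (c + a + x + 1) * (c + x + a).factorial := by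
    rw [show c + a + x + 1 = c + x + a + 1 by ring, Nat.factorial_succ]
    push_cast
    ring
  rw [e1, e2, show c + a + x + 1 + a = c + 2 * a + 1 + x by ring,
    show b + c + 2 * a + 1 + x + x = b + c + 2 * a + 1 + 2 * x by ring,
    show b + c + 2 * a + 1 + (x + 1) + x = b + c + 2 * a + 2 + 2 * x by ring]
  field_simp

/-! ### Trapezoidal products -/

/-- Negative `n` is needed, since lengths `2a + b + c - 2i` with `i < b` occur. The hypothesis then
keeps the denominators nonzero. -/
theorem poch_add_one {z : ℚ} {n : ℤ} (hn : 0 < z + n) :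
    poch (z + 1) n * z = poch z n * (z + n) := by
  rcases le_or_gt 0 n with h | h
  · obtain ⟨n, rfl⟩ := Int.eq_ofNat_of_zero_le h
    have h1 := Finset.prod_range_succ (fun i : ℕ => z + i) n
    rw [Finset.prod_range_succ'] at h1
    simp only [poch, if_pos h, Int.toNat_natCast, Int.cast_natCast]
    rw [← h1, Nat.cast_zero, add_zero]
    congr 1
    exact Finset.prod_congr rfl fun i _ => by push_cast; ring
  · obtain ⟨k, rfl⟩ : ∃ k : ℕ, n = -k := ⟨(-n).toNat, by omega⟩
    have h1 := Finset.prod_range_succ (fun i : ℕ => z - i) k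
    rw [Finset.prod_range_succ'] at h1
    push_cast at hn
    simp only [poch, if_neg (not_le.2 h), neg_neg, Int.toNat_natCast]
    have h2 : ∏ i ∈ Finset.range k, (z + 1 - ((i : ℚ) + 1)) = ∏ i ∈ Finset.range k, (z - i) :=
      Finset.prod_congr rfl fun i _ => by ring
    have h3 : ∀ i ∈ Finset.range k, z - ((i : ℚ) + 1) ≠ 0 := fun i hi => by
      have : (i : ℚ) + 1 ≤ k := by exact_mod_cast Finset.mem_range.1 hi
      exact (by linarith : 0 < z - ((i : ℚ) + 1)).ne'
    have h4 : ∀ i ∈ Finset.range k, z - (i : ℚ) ≠ 0 := fun i hi => by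
      have : (i : ℚ) + 1 ≤ k := by exact_mod_cast Finset.mem_range.1 hi
      exact (by linarith : 0 < z - (i : ℚ)).ne'
    have h5 := Finset.prod_ne_zero_iff.2 h3
    have h6 := Finset.prod_ne_zero_iff.2 h4
    push_cast at h1 ⊢
    rw [sub_zero] at h1
    rw [h2, inv_mul_eq_div, inv_mul_eq_div, div_eq_div_iff h6 h5, mul_comm z, h1]
    ring

theorem poch_pos {z : ℚ} {n : ℤ} (hz : 0 < z) (hn : 0 < z + n) : 0 < poch z n := by
  rw [poch]
  split_ifs with h
  · exact Finset.prod_pos fun i _ => by positivity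
  · obtain ⟨k, rfl⟩ : ∃ k : ℕ, n = -k := ⟨(-n).toNat, by omega⟩
    push_cast at hn
    rw [neg_neg, Int.toNat_natCast]
    refine inv_pos.2 (Finset.prod_pos fun i hi => ?_)
    have : (i : ℚ) + 1 ≤ k := by exact_mod_cast Finset.mem_range.1 hi
    linarith

theorem skipPoch_add_two (z : ℚ) {n : ℤ} (hn : 0 ≤ n) :
    skipPoch (z + 2) n * z = skipPoch z n * (z + 2 * n) := by
  obtain ⟨n, rfl⟩ := Int.eq_ofNat_of_zero_le hn
  have h1 := Finset.prod_range_succ (fun i : ℕ => z + 2 * i) n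
  rw [Finset.prod_range_succ'] at h1
  simp only [skipPoch, if_pos hn, Int.toNat_natCast, Int.cast_natCast]
  rw [← h1, Nat.cast_zero, mul_zero, add_zero]
  congr 1
  exact Finset.prod_congr rfl fun i _ => by push_cast; ring

theorem skipPoch_pos {z : ℚ} {n : ℤ} (hz : 0 < z) (hn : 0 ≤ n) : 0 < skipPoch z n := by
  rw [skipPoch, if_pos hn]
  exact Finset.prod_pos fun i _ => by positivity

theorem trapT_natCast (z : ℚ) (n : ℤ) (m : ℕ) :
    trapT z n m = ∏ i ∈ Finset.range m, poch (z + i) (n - 2 * i) := by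
  rw [trapT, if_pos (Int.natCast_nonneg m), Int.toNat_natCast]

theorem trapV_natCast (z : ℚ) (n : ℤ) (m : ℕ) :
    trapV z n m = ∏ i ∈ Finset.range m, skipPoch (z + 2 * i) (n - 2 * i) := by
  rw [trapV, if_pos (Int.natCast_nonneg m), Int.toNat_natCast]

theorem trapT_add_one {z : ℚ} {n : ℤ} {m : ℕ} (h : ∀ i < m, 0 < z + n - i) :
    trapT (z + 1) n m * ∏ i ∈ Finset.range m, (z + i) =
      trapT z n m * ∏ i ∈ Finset.range m, (z + n - i) := by
  rw [trapT_natCast, trapT_natCast, ← Finset.prod_mul_distrib, ← Finset.prod_mul_distrib]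
  refine Finset.prod_congr rfl fun i hi => ?_
  have h1 := h i (Finset.mem_range.1 hi)
  have h2 : z + i + (n - 2 * i : ℤ) = z + n - i := by push_cast; ring
  rw [add_right_comm, poch_add_one (by rw [h2]; exact h1), h2]

theorem trapT_pos {z : ℚ} {n : ℤ} {m : ℕ} (hz : 0 < z) (h : ∀ i < m, 0 < z + n - i) :
    0 < trapT z n m := by
  rw [trapT_natCast]
  refine Finset.prod_pos fun i hi => poch_pos (by positivity) ?_
  have h1 := h i (Finset.mem_range.1 hi)
  push_cast
  linarith

theorem trapV_add_two {z : ℚ} {n : ℤ} {m : ℕ} (h : ∀ i < m, 0 ≤ n - 2 * i) :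
    trapV (z + 2) n m * ∏ i ∈ Finset.range m, (z + 2 * i) =
      trapV z n m * ∏ i ∈ Finset.range m, (z + 2 * n - 2 * i) := by
  rw [trapV_natCast, trapV_natCast, ← Finset.prod_mul_distrib, ← Finset.prod_mul_distrib]
  refine Finset.prod_congr rfl fun i hi => ?_
  have h2 : z + 2 * i + 2 * (n - 2 * i : ℤ) = z + 2 * n - 2 * i := by push_cast; ring
  rw [add_right_comm, skipPoch_add_two _ (h i (Finset.mem_range.1 hi)), h2]

theorem trapV_pos {z : ℚ} {n : ℤ} {m : ℕ} (hz : 0 < z) (h : ∀ i < m, 0 ≤ n - 2 * i) :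
    0 < trapV z n m := by
  rw [trapV_natCast]
  exact Finset.prod_pos fun i hi => skipPoch_pos (by positivity) (h i (Finset.mem_range.1 hi))

/-! ### Linear factors of the trapezoidal products -/

theorem prod_range_two_mul_add (y m : ℕ) :
    ((y + 1).factorial : ℚ) * ((∏ i ∈ Finset.range m, ((y : ℚ) + 2 + 2 * i)) *
      ∏ i ∈ Finset.range m, ((y : ℚ) + 3 + 2 * i)) = (y + 1 + 2 * m).factorial := by
  induction m with
  | zero => simp
  | succ m ih =>
    rw [show y + 1 + 2 * (m + 1) = y + 1 + 2 * m + 1 + 1 by ring,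
      Nat.factorial_succ (y + 1 + 2 * m + 1), Nat.factorial_succ (y + 1 + 2 * m), Nat.cast_mul, Nat.cast_mul, ← ih, Finset.prod_range_succ,
      Finset.prod_range_succ]
    push_cast
    ring

theorem prod_range_sub_two_mul {y c m : ℕ} (hm : m ≤ c + 1) :
    ((y + 2 * c + 2 - 2 * m).factorial : ℚ) *
      ((∏ i ∈ Finset.range m, ((y : ℚ) + 2 * c + 2 - 2 * i)) *
      ∏ i ∈ Finset.range m, ((y : ℚ) + 2 * c + 1 - 2 * i)) = (y + 2 * c + 2).factorial := by
  induction m with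
  | zero => simp
  | succ m ih =>
    rw [← ih (by omega), show y + 2 * c + 2 - 2 * m = y + 2 * c + 2 - 2 * (m + 1) + 1 + 1 by omega,
      Nat.factorial_succ (y + 2 * c + 2 - 2 * (m + 1) + 1),
      Nat.factorial_succ (y + 2 * c + 2 - 2 * (m + 1)), Nat.cast_mul,
      Nat.cast_mul, Finset.prod_range_succ, Finset.prod_range_succ]
    push_cast [Nat.cast_sub (show 2 * (m + 1) ≤ y + 2 * c + 2 by omega)]
    ring

/-- The two factorials on the left are those on the right, in an order given by the parity of `c`;
so the floor disappears from the quotient. -/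
theorem factorial_mul_factorial_of_half {y c m : ℕ} (hm : m = (c + 1) / 2) :
    (y + 1 + 2 * m).factorial * (y + 2 * c + 2 - 2 * m).factorial =
      (y + c + 1).factorial * (y + c + 2).factorial := by
  rcases Nat.even_or_odd c with h | h <;> simp only [Nat.even_iff, Nat.odd_iff] at h
  · rw [show y + 1 + 2 * m = y + c + 1 by omega, show y + 2 * c + 2 - 2 * m = y + c + 2 by omega]
  · rw [show y + 1 + 2 * m = y + c + 2 by omega, show y + 2 * c + 2 - 2 * m = y + c + 1 by omega,
      mul_comm]

/-- The step of a product of two trapezoidal products, expressed by its linear factors. -/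
theorem step_of_linear_factors {y c m : ℕ} (hm : m = (c + 1) / 2) {V V' T T' : ℚ}
    (h : (V' * T') * ((∏ i ∈ Finset.range m, ((y : ℚ) + 2 + 2 * i)) *
        ∏ i ∈ Finset.range m, ((y : ℚ) + 3 + 2 * i)) =
      (V * T) * ((∏ i ∈ Finset.range m, ((y : ℚ) + 2 * c + 2 - 2 * i)) *
        ∏ i ∈ Finset.range m, ((y : ℚ) + 2 * c + 1 - 2 * i))) :
    V' * T' = V * T * (((y + 1).factorial * (y + 2 * c + 2).factorial) /
      ((y + c + 1).factorial * (y + c + 2).factorial)) := by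
  have h1 := prod_range_two_mul_add y m
  have h2 := prod_range_sub_two_mul (y := y) (c := c) (m := m) (by omega)
  have h3 : ((y + 1 + 2 * m).factorial : ℚ) * (y + 2 * c + 2 - 2 * m).factorial =
      (y + c + 1).factorial * (y + c + 2).factorial := by
    exact_mod_cast factorial_mul_factorial_of_half hm
  rw [← mul_div_assoc, eq_div_iff (by positivity), ← h3, ← h1, ← h2]
  linear_combination ((y + 1).factorial : ℚ) * (y + 2 * c + 2 - 2 * m).factorial * h

theorem prod_range_scale (m : ℕ) (f g : ℕ → ℚ) (h : ∀ i, f i = 2 * g i) :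
    ∏ i ∈ Finset.range m, f i = 2 ^ m * ∏ i ∈ Finset.range m, g i := by
  rw [Finset.prod_congr rfl fun i _ => h i, Finset.prod_mul_distrib, Finset.prod_const,
    Finset.card_range]

theorem trapV_mul_trapT_succ_of_odd (x a b c : ℕ) :
    trapV (2 * (x + 1 : ℕ) + 2 * a + b + 2) c (((c : ℤ) + 1) / 2) *
      trapT ((x + 1 : ℕ) + a + (b + 3) / 2) ((c : ℤ) - 1) (((c : ℤ) + 1) / 2) =
    trapV (2 * x + 2 * a + b + 2) c (((c : ℤ) + 1) / 2) *
      trapT (x + a + (b + 3) / 2) ((c : ℤ) - 1) (((c : ℤ) + 1) / 2) *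
      (((2 * x + 2 * a + b + 1).factorial * (2 * x + 2 * a + b + 2 * c + 2).factorial) /
      ((2 * x + 2 * a + b + c + 1).factorial * (2 * x + 2 * a + b + c + 2).factorial)) := by
  obtain ⟨m, hm⟩ : ∃ m, m = (c + 1) / 2 := ⟨_, rfl⟩
  have hm' : ((c : ℤ) + 1) / 2 = (m : ℕ) := by omega
  rw [hm']
  refine step_of_linear_factors hm ?_
  have h1 := trapV_add_two (z := 2 * x + 2 * a + b + 2) (n := c) (m := m) (fun i hi => by omega)
  have h2 := trapT_add_one (z := x + a + (b + 3) / 2) (n := (c : ℤ) - 1) (m := m)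
    (fun i hi => by
      have : (i : ℚ) + 1 ≤ c := by exact_mod_cast (by omega : i + 1 ≤ c)
      push_cast
      have : (0 : ℚ) ≤ x + a + b / 2 := by positivity
      linarith)
  rw [show (2 * (x + 1 : ℕ) + 2 * a + b + 2 : ℚ) = 2 * x + 2 * a + b + 2 + 2 by push_cast; ring,
    show ((x + 1 : ℕ) + a + (b + 3) / 2 : ℚ) = x + a + (b + 3) / 2 + 1 by push_cast; ring]
  -- Doubling the factors of `T` puts them on the scale of those of `V`: together they fill the gaps
  -- to runs of consecutive integers, and the powers of 2 cancel.
  have e1 := prod_range_scale m (fun i => ((2 * x + 2 * a + b : ℕ) : ℚ) + 3 + 2 * i)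
    (fun i => x + a + (b + 3) / 2 + i) fun i => by push_cast; ring
  have e2 := prod_range_scale m (fun i => ((2 * x + 2 * a + b : ℕ) : ℚ) + 2 * c + 1 - 2 * i)
    (fun i => x + a + (b + 3) / 2 + ((c : ℤ) - 1 : ℤ) - i) fun i => by push_cast; ring
  have e3 : ∏ i ∈ Finset.range m, (((2 * x + 2 * a + b : ℕ) : ℚ) + 2 + 2 * i) =
      ∏ i ∈ Finset.range m, ((2 * x + 2 * a + b + 2 : ℚ) + 2 * i) :=
    Finset.prod_congr rfl fun i _ => by push_cast; ring
  have e4 : ∏ i ∈ Finset.range m, (((2 * x + 2 * a + b : ℕ) : ℚ) + 2 * c + 2 - 2 * i) =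
      ∏ i ∈ Finset.range m, ((2 * x + 2 * a + b + 2 : ℚ) + 2 * (c : ℤ) - 2 * i) :=
    Finset.prod_congr rfl fun i _ => by push_cast; ring
  rw [e1, e2, e3, e4]
  have h3 := congrArg₂ (· * ·) h1 h2
  linear_combination (2 : ℚ) ^ m * h3

theorem trapV_mul_trapT_succ_of_even (x a b c : ℕ) :
    trapV (2 * (x + 1 : ℕ) + 2 * a + b + 3) ((c : ℤ) - 1) (((c : ℤ) + 1) / 2) *
      trapT ((x + 1 : ℕ) + a + (b + 2) / 2) c (((c : ℤ) + 1) / 2) =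
    trapV (2 * x + 2 * a + b + 3) ((c : ℤ) - 1) (((c : ℤ) + 1) / 2) *
      trapT (x + a + (b + 2) / 2) c (((c : ℤ) + 1) / 2) *
      (((2 * x + 2 * a + b + 1).factorial * (2 * x + 2 * a + b + 2 * c + 2).factorial) /
      ((2 * x + 2 * a + b + c + 1).factorial * (2 * x + 2 * a + b + c + 2).factorial)) := by
  obtain ⟨m, hm⟩ : ∃ m, m = (c + 1) / 2 := ⟨_, rfl⟩
  have hm' : ((c : ℤ) + 1) / 2 = (m : ℕ) := by omega
  rw [hm']
  refine step_of_linear_factors hm ?_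
  have h1 := trapV_add_two (z := 2 * x + 2 * a + b + 3) (n := (c : ℤ) - 1) (m := m)
    (fun i hi => by omega)
  have h2 := trapT_add_one (z := x + a + (b + 2) / 2) (n := c) (m := m)
    (fun i hi => by
      have : (i : ℚ) + 1 ≤ c := by exact_mod_cast (by omega : i + 1 ≤ c)
      push_cast
      have : (0 : ℚ) ≤ x + a + b / 2 := by positivity
      linarith)
  rw [show (2 * (x + 1 : ℕ) + 2 * a + b + 3 : ℚ) = 2 * x + 2 * a + b + 3 + 2 by push_cast; ring,
    show ((x + 1 : ℕ) + a + (b + 2) / 2 : ℚ) = x + a + (b + 2) / 2 + 1 by push_cast; ring]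
  -- Here `V` and `T` exchange the two residue classes modulo 2, with the same union.
  have e1 := prod_range_scale m (fun i => ((2 * x + 2 * a + b : ℕ) : ℚ) + 2 + 2 * i)
    (fun i => x + a + (b + 2) / 2 + i) fun i => by push_cast; ring
  have e2 := prod_range_scale m (fun i => ((2 * x + 2 * a + b : ℕ) : ℚ) + 2 * c + 2 - 2 * i)
    (fun i => x + a + (b + 2) / 2 + (c : ℤ) - i) fun i => by push_cast; ring
  have e3 : ∏ i ∈ Finset.range m, (((2 * x + 2 * a + b : ℕ) : ℚ) + 3 + 2 * i) =
      ∏ i ∈ Finset.range m, ((2 * x + 2 * a + b + 3 : ℚ) + 2 * i) :=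
    Finset.prod_congr rfl fun i _ => by push_cast; ring
  have e4 : ∏ i ∈ Finset.range m, (((2 * x + 2 * a + b : ℕ) : ℚ) + 2 * c + 1 - 2 * i) =
      ∏ i ∈ Finset.range m, ((2 * x + 2 * a + b + 3 : ℚ) + 2 * ((c : ℤ) - 1 : ℤ) - 2 * i) :=
    Finset.prod_congr rfl fun i _ => by push_cast; ring
  rw [e1, e2, e3, e4]
  have h3 := congrArg₂ (· * ·) h1 h2
  linear_combination (2 : ℚ) ^ m * h3

theorem trapT_box_succ (x a b c : ℕ) :
    trapT ((x + 1 : ℕ) + 1) (2 * a + b + c) b = trapT (x + 1) (2 * a + b + c) b *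
      ((x.factorial * (b + c + 2 * a + 1 + x).factorial) /
        ((c + 2 * a + 1 + x).factorial * (b + x).factorial)) := by
  have h1 := trapT_add_one (z := x + 1) (n := 2 * a + b + c) (m := b) (fun i hi => by
    have : (i : ℚ) + 1 ≤ b := by exact_mod_cast hi
    have : (0 : ℚ) ≤ x + a + c + a := by positivity
    push_cast
    linarith)
  have h2 := prod_range_add_natCast x b
  have h3 := prod_range_add_natCast (c + 2 * a + 1 + x) b
  rw [← Finset.prod_range_reflect] at h3
  have e1 : ∏ i ∈ Finset.range b, (((c + 2 * a + 1 + x : ℕ) : ℚ) + 1 + (b - 1 - i : ℕ)) =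
      ∏ i ∈ Finset.range b, ((x : ℚ) + 1 + (2 * a + b + c : ℤ) - i) := by
    refine Finset.prod_congr rfl fun i hi => ?_
    rw [Finset.mem_range] at hi
    rw [show b - 1 - i = b - (i + 1) by omega, Nat.cast_sub (by omega)]
    push_cast
    ring
  rw [e1] at h3
  rw [show b + c + 2 * a + 1 + x = c + 2 * a + 1 + x + b by ring, add_comm b x, h2, h3]
  have e2 : (x.factorial : ℚ) ≠ 0 := by positivity
  have e3 : ((c + 2 * a + 1 + x).factorial : ℚ) ≠ 0 := by positivity
  have e4 : ∏ i ∈ Finset.range b, ((x : ℚ) + 1 + i) ≠ 0 :=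
    Finset.prod_ne_zero_iff.2 fun i _ => by positivity
  rw [← mul_div_assoc, eq_div_iff (by positivity)]
  push_cast at h1 ⊢
  linear_combination ((c + 2 * a + 1 + x).factorial : ℚ) * x.factorial * h1

/-! ### Comparison of the two recursions -/

theorem eq_mul_div_of_succ_eq_mul {u v ρ : ℕ → ℚ} (hu : ∀ x, u (x + 1) = u x * ρ x)
    (hv : ∀ x, v (x + 1) = v x * ρ x) (h0 : v 0 ≠ 0) (x : ℕ) : u x = u 0 * (v x / v 0) := by
  induction x with
  | zero => rw [div_self h0, mul_one]
  | succ x ih =>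
    rw [hu, hv, ih]
    ring

theorem tilingNumber_regionB_succ (x a b c : ℕ) :
    (tilingNumber (regionB (x + 1) a b c) : ℚ) =
      tilingNumber (regionB x a b c) * tilingRatio x a b c := by
  rw [tilingNumber_regionB_eq_tilingProduct, tilingNumber_regionB_eq_tilingProduct,
    tilingProduct_succ, mul_assoc]

theorem tilingNumber_regionB_zero (a b c : ℕ) :
    (tilingNumber (regionB 0 a b c) : ℚ) = tilingNumber (regionP c c a) := by
  rw [tilingNumber_regionB, tilingNumber_regionP a b c]

theorem tilingRatio_eq (x a b c : ℕ) : tilingRatio x a b c =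
    (((2 * x + 2 * a + b + 1).factorial * (2 * x + 2 * a + b + 2 * c + 2).factorial) /
      ((2 * x + 2 * a + b + c + 1).factorial * (2 * x + 2 * a + b + c + 2).factorial)) *
    ((x.factorial * (b + c + 2 * a + 1 + x).factorial) /
        ((c + 2 * a + 1 + x).factorial * (b + x).factorial)) := by
  rw [tilingRatio, show b + 2 * a + 1 + 2 * x = 2 * x + 2 * a + b + 1 by ring,
    show b + 2 * c + 2 * a + 2 + 2 * x = 2 * x + 2 * a + b + 2 * c + 2 by ring,
    show b + c + 2 * a + 1 + 2 * x = 2 * x + 2 * a + b + c + 1 by ring,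
    show b + c + 2 * a + 2 + 2 * x = 2 * x + 2 * a + b + c + 2 by ring]
  field_simp

theorem trapT_box_pos (a b c : ℕ) : 0 < trapT 1 (2 * a + b + c) b :=
  trapT_pos one_pos fun i hi => by
    have : (i : ℚ) + 1 ≤ b := by exact_mod_cast hi
    have : (0 : ℚ) ≤ a + c + a := by positivity
    push_cast
    linarith

theorem theorem2p3 (x a b c : ℕ) :
    (Odd b →
      (tilingNumber (regionB x a b c) : ℚ) =
        (tilingNumber (regionP c c a) : ℚ) *
          (trapV (2 * x + 2 * a + b + 2) c (((c : ℤ) + 1) / 2) /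
            trapV (2 * a + b + 2) c (((c : ℤ) + 1) / 2)) *
          ((trapT (x + 1) (2 * a + b + c) b *
              trapT (x + a + (b + 3) / 2) ((c : ℤ) - 1) (((c : ℤ) + 1) / 2)) /
            (trapT 1 (2 * a + b + c) b *
              trapT (a + (b + 3) / 2) ((c : ℤ) - 1) (((c : ℤ) + 1) / 2)))) ∧
    (Even b →
      (tilingNumber (regionB x a b c) : ℚ) =
        (tilingNumber (regionP c c a) : ℚ) *
          (trapV (2 * x + 2 * a + b + 3) ((c : ℤ) - 1) (((c : ℤ) + 1) / 2) /
            trapV (2 * a + b + 3) ((c : ℤ) - 1) (((c : ℤ) + 1) / 2)) *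
          ((trapT (x + 1) (2 * a + b + c) b *
              trapT (x + a + (b + 2) / 2) c (((c : ℤ) + 1) / 2)) /
            (trapT 1 (2 * a + b + c) b *
              trapT (a + (b + 2) / 2) c (((c : ℤ) + 1) / 2)))) := by
  have hm : ((c : ℤ) + 1) / 2 = ((c + 1) / 2 : ℕ) := by omega
  have hc : ∀ i < (c + 1) / 2, (i : ℚ) + 1 ≤ c := fun i hi => by
    exact_mod_cast (by omega : i + 1 ≤ c)
  have hab : (0 : ℚ) ≤ a + b / 2 := by positivity
  constructor
  · intro _
    have h := eq_mul_div_of_succ_eq_mul (u := fun x => (tilingNumber (regionB x a b c) : ℚ))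
      -- The part of the formula that depends on `x`; its value at 0 is the denominator, nonzero by
      -- positivity.
      (v := fun x : ℕ => trapV (2 * x + 2 * a + b + 2) c (((c : ℤ) + 1) / 2) *
        trapT (x + a + (b + 3) / 2) ((c : ℤ) - 1) (((c : ℤ) + 1) / 2) *
        trapT (x + 1) (2 * a + b + c) b) (ρ := fun x => tilingRatio x a b c)
      (fun x => tilingNumber_regionB_succ x a b c)
      (fun x => by
        rw [trapV_mul_trapT_succ_of_odd, trapT_box_succ, tilingRatio_eq]
        ring)
      (by
        simp only [Nat.cast_zero, mul_zero, zero_add]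
        refine (mul_pos (mul_pos ?_ ?_) (trapT_box_pos a b c)).ne'
        · rw [hm]
          exact trapV_pos (by positivity) fun i hi => by omega
        · rw [hm]
          refine trapT_pos (by positivity) fun i hi => ?_
          have := hc i hi
          push_cast
          linarith) x
    simp only [Nat.cast_zero, mul_zero, zero_add] at h
    rw [h, tilingNumber_regionB_zero]
    simp only [div_eq_mul_inv, mul_inv]
    ring
  · intro _
    have h := eq_mul_div_of_succ_eq_mul (u := fun x => (tilingNumber (regionB x a b c) : ℚ))
      (v := fun x : ℕ => trapV (2 * x + 2 * a + b + 3) ((c : ℤ) - 1) (((c : ℤ) + 1) / 2) *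
        trapT (x + a + (b + 2) / 2) c (((c : ℤ) + 1) / 2) *
        trapT (x + 1) (2 * a + b + c) b) (ρ := fun x => tilingRatio x a b c)
      (fun x => tilingNumber_regionB_succ x a b c)
      (fun x => by
        rw [trapV_mul_trapT_succ_of_even, trapT_box_succ, tilingRatio_eq]
        ring)
      (by
        simp only [Nat.cast_zero, mul_zero, zero_add]
        refine (mul_pos (mul_pos ?_ ?_) (trapT_box_pos a b c)).ne'
        · rw [hm]
          exact trapV_pos (by positivity) fun i hi => by omega
        · rw [hm]
          refine trapT_pos (by positivity) fun i hi => ?_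
          have := hc i hi
          push_cast
          linarith) x
    simp only [Nat.cast_zero, mul_zero, zero_add] at h
    rw [h, tilingNumber_regionB_zero]
    simp only [div_eq_mul_inv, mul_inv]
    ring
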